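/- Let $\psi:[1,\infty)\to(0,\infty)$ be convex and continuous with $\lim_{t\to\infty}\psi(t)=0$. Put $\eta(t)=\psi^{-1}(\psi(t)/2)$, where $\psi^{-1}$ is the inverse function of $\psi$ on $[1,\infty)$, and $\mu(t)=\dfrac{t}{\eta(t)-t}$, and write $\psi'$ for the right-hand derivative of $\psi$ (the derivative, wherever $\psi$ is differentiable). A function is said to increase to $\infty$ as $t\to\infty$ if it is nondecreasing for all large $t$ and tends to $\infty$. Assume that (i) $\mu(t)$ increases to $\infty$ as $t\to\infty$, and there is $K>0$ with $\eta(t)-t\ge K$ for all $t\ge 1$ (that is, $\psi\in\mathfrak M''_\infty$); (ii) $\psi(t)/|\psi'(t)|$ increases to $\infty$ as $t\to\infty$. For $1\le s<\infty$ let $\|f\|_s=\big(\int_0^{2\pi}|f(t)|^s\,dt\big)^{1/s}$, let $\|f\|_\infty$ be the essential supremum of $|f|$, and let $\hat f(k)=\frac1{2\pi}\int_{-\pi}^{\pi}f(t)e^{-ikt}\,dt$. For $\beta\in\mathbb R$ and $1<p<\infty$ let $L^\psi_{\beta,p}$ be the class of all real-valued $2\pi$-periodic functions $f$, integrable over a period,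 for which there is a real-valued $2\pi$-periodic $\varphi$ with $\|\varphi\|_p\le 1$ and $\int_0^{2\pi}\varphi(t)\,dt=0$ whose Fourier series is $$\sum_{k\in\mathbb Z\setminus\{0\}}\frac{\hat f(k)}{\psi(|k|)}\,e^{i\left(kx+\frac{\beta\pi}{2}\operatorname{sign}k\right)}.$$ For $m\in\mathbb N$ define $$e^\bot_m(L^\psi_{\beta,p})_\infty=\sup_{f\in L^\psi_{\beta,p}}\ \inf_{\gamma\subset\mathbb Z,\ |\gamma|=m}\Big\|f(\cdot)-\sum_{k\in\gamma}\hat f(k)e^{ik\,\cdot}\Big\|_\infty .$$ Theorem. Let $1<p<\infty$ and let $\psi$ satisfy (i) and (ii). Then for every $\beta\in\mathbb R$ $$e^\bot_{2n-1}(L^\psi_{\beta,p})_\infty\asymp e^\bot_{2n}(L^\psi_{\beta,p})_\infty\asymp\psi(n)\,(\eta(n)-n)^{1/p},$$ where $a_n\asymp b_n$ means that there are constants $C_1,C_2>0$ independent of $n$ with $C_1a_n\le b_n\le C_2a_n$ for all $n\in\mathbb N$, $n\ge1$. -/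

import Mathlib

open MeasureTheory Filter Topology
open scoped ENNReal NNReal

noncomputable section

namespace OrthApprox

/-- The circle `ℝ / 2πℤ`; functions on it are the `2π`-periodic functions on `ℝ`.  Its `volume`
has total mass `2π`, whereas `fourierCoeff` integrates against the normalized measure, so that
`fourierCoeff f k = (1 / 2π) ∫ f(t) e^{-ikt} dt` over a period, and `fourier k x = e^{ikx}`. -/
abbrev Circle2Pi : Type := AddCircle (2 * Real.pi)

instance instFactTwoPiPos : Fact (0 < 2 * Real.pi) := ⟨Real.two_pi_pos⟩

/-- The `k`-th Fourier coefficient of a real-valued `2π`-periodic function. -/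
def fcoeff (f : Circle2Pi → ℝ) (k : ℤ) : ℂ :=
  fourierCoeff (fun x => (f x : ℂ)) k

/-- `φ` is the `(ψ, β)`-derivative of `f`: `φ` is summable and its Fourier series is
`∑_{k ≠ 0} (f̂(k) / ψ(|k|)) e^{i (k x + (β π / 2) sign k)}`. -/
def IsPsiBetaDeriv (ψ : ℝ → ℝ) (β : ℝ) (f φ : Circle2Pi → ℝ) : Prop :=
  Integrable φ ∧ fcoeff φ 0 = 0 ∧
    ∀ k : ℤ, k ≠ 0 → fcoeff φ k =
      fcoeff f k / ((ψ |(k : ℝ)| : ℝ) : ℂ) *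
        Complex.exp (Complex.I * ((β * Real.pi / 2 * (k.sign : ℝ) : ℝ) : ℂ))

/-- The set `B_p^0` of the functions `φ` in the unit ball of `L_p` with `φ ⊥ 1`. -/
def unitBallZero (p : ℝ≥0∞) : Set (Circle2Pi → ℝ) :=
  {φ | MemLp φ p ∧ eLpNorm φ p ≤ 1 ∧ ∫ x, φ x = 0}

/-- The class `L^ψ_{β,p}`. -/
def psiBetaClass (ψ : ℝ → ℝ) (β : ℝ) (p : ℝ≥0∞) : Set (Circle2Pi → ℝ) :=
  {f | Integrable f ∧ ∃ φ, IsPsiBetaDeriv ψ β f φ ∧ φ ∈ unitBallZero p}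

/-- The partial Fourier sum `S_γ(f; x) = ∑_{k ∈ γ} f̂(k) e^{ikx}`. -/
def partialSum (γ : Finset ℤ) (f : Circle2Pi → ℝ) (x : Circle2Pi) : ℂ :=
  ∑ k ∈ γ, fcoeff f k * fourier k x

/-- The best orthogonal trigonometric approximation `e^⊥_m(f)_s` (possibly `∞`). -/
def bestOrth (m : ℕ) (s : ℝ≥0∞) (f : Circle2Pi → ℝ) : ℝ≥0∞ :=
  ⨅ γ : {γ : Finset ℤ // γ.card = m},
    eLpNorm (fun x => (f x : ℂ) - partialSum γ.1 f x) s

/-- The best orthogonal trigonometric approximation `e^⊥_m(F)_s = sup_{f ∈ F} e^⊥_m(f)_s` of a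
class `F` (possibly `∞`). -/
def bestOrthClass (m : ℕ) (s : ℝ≥0∞) (F : Set (Circle2Pi → ℝ)) : ℝ≥0∞ :=
  ⨆ f ∈ F, bestOrth m s f

/-- The set `𝔐` of the positive convex continuous functions on `[1, ∞)` that tend to `0` at
infinity.  (The values of `ψ` to the left of `1` are irrelevant.) -/
structure MemM (ψ : ℝ → ℝ) : Prop where
  pos : ∀ t, 1 ≤ t → 0 < ψ t
  convex : ConvexOn ℝ (Set.Ici 1) ψ
  cont : ContinuousOn ψ (Set.Ici 1)
  lim : Tendsto ψ atTop (𝓝 0)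

/-- `η(t) = ψ⁻¹(ψ(t) / 2)`, with `ψ⁻¹` the inverse of the restriction of `ψ` to `[1, ∞)`. -/
def eta (ψ : ℝ → ℝ) (t : ℝ) : ℝ :=
  Function.invFunOn ψ (Set.Ici 1) (ψ t / 2)

/-- `μ(t) = t / (η(t) - t)`. -/
def mu (ψ : ℝ → ℝ) (t : ℝ) : ℝ :=
  t / (eta ψ t - t)

/-- `g(t) ↑ ∞` as `t → ∞`: `g` is nondecreasing for all large `t`, and tends to infinity. -/
def IncreasesToInfinity (g : ℝ → ℝ) : Prop :=
  (∃ t₀, MonotoneOn g (Set.Ici t₀)) ∧ Tendsto g atTop atTop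

/-- The set `𝔐⁺_∞`. -/
structure MemMPlus (ψ : ℝ → ℝ) : Prop extends MemM ψ where
  mu_increases : IncreasesToInfinity (mu ψ)

/-- The set `𝔐''_∞`. -/
structure MemMTwo (ψ : ℝ → ℝ) : Prop extends MemMPlus ψ where
  eta_sub_ge : ∃ K : ℝ, 0 < K ∧ ∀ t, 1 ≤ t → K ≤ eta ψ t - t

/-- The right-hand derivative `ψ'(t)`.  A convex function has one at each interior point of its
domain, and it is the derivative wherever `ψ` is differentiable. -/
def rightDeriv (ψ : ℝ → ℝ) (t : ℝ) : ℝ :=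
  derivWithin ψ (Set.Ioi t) t

/-- `a_n ≍ b_n`: for some positive constants, `C₁ a_n ≤ b_n ≤ C₂ a_n` for all `n ≥ 1`. -/
def SameOrder (a b : ℕ → ℝ≥0∞) : Prop :=
  ∃ C₁ C₂ : ℝ≥0, 0 < C₁ ∧ 0 < C₂ ∧
    ∀ n : ℕ, 1 ≤ n → (C₁ : ℝ≥0∞) * a n ≤ b n ∧ b n ≤ (C₂ : ℝ≥0∞) * a n

end OrthApprox

end

/-! Write a = η(n) - n. Both bounds rest on one fact: a trigonometric sum dominated by B min(a,
1/|x|) on a period has L_q norm of order at most B a^(1 - 1/q), for q > 1. The bound B/|x| comes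
from Abel summation when the coefficients are monotone; the bound B a is the sum of the
coefficients.

Upper bound. Harmonics |k| < n are kept. The rest of f is a convolution of its (ψ, β)-derivative
with the tail of ∑ ψ(k) e^{ikx}, up to a phase and conjugation, so Hölder's inequality asks for the
L_q norm of that tail, 1/p + 1/q = 1. Since μ grows, successive intervals between halvings of ψ
lengthen by a factor at most 5/4, so the sum of ψ(k) over k ≥ n is dominated by a geometric series
and is O(ψ(n) a) (`exists_sum_Ico_le`). The kernel therefore has L_q norm O(ψ(n) a^(1/p)).

Lower bound. The test function is 2w ∑ cos kx over 1 ≤ k ≤ N, with N = ⌈η(n)⌉. Its (ψ, β)-derivative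
has coefficients of modulus w/ψ(k), which increase with k; condition (ii) makes 1/ψ grow fast enough
that ∑ ψ(n)/ψ(k) over k ≤ N is O(a) (`exists_sum_inv_le`). Hence w may be taken of order ψ(n) a^(1/p
- 1). Whichever 2n harmonics are removed, at least 2N - 2n equal coefficients w survive, and testing
against a Fejér kernel shows that the remainder has uniform norm at least w(N - n) ≥ w a, which is
of order ψ(n) a^(1/p) (`le_eLpNorm_dirichlet_sub_partialSum`). -/

namespace OrthApprox

/-! ### Abel summation for trigonometric sums with monotone coefficients -/

/-- Abel summation: a power sum with nonincreasing nonnegative coefficients. -/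
theorem norm_one_sub_mul_sum_le (z : ℂ) (hz : ‖z‖ = 1) (c : ℕ → ℝ) (M : ℕ)
    (hc0 : ∀ k < M, 0 ≤ c k) (hc : ∀ k, k + 1 < M → c (k + 1) ≤ c k) (h0 : 0 ≤ c 0) :
    ‖(1 - z) * ∑ k ∈ Finset.range M, (c k : ℂ) * z ^ k‖ ≤ 2 * c 0 := by
  rcases M with _ | M
  · simpa using h0
  -- Adding the boundary term of the Abel summation makes the induction close: each step contributes
  -- c m - c (m + 1), and these differences telescope.
  have key : ∀ m ≤ M, ‖(1 - z) * (∑ k ∈ Finset.range (m + 1), (c k : ℂ) * z ^ k)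
      + c m * z ^ (m + 1)‖ ≤ 2 * c 0 - c m := by
    intro m
    induction m with
    | zero =>
      intro _
      have : (1 - z) * (∑ k ∈ Finset.range (0 + 1), (c k : ℂ) * z ^ k) + c 0 * z ^ (0 + 1)
          = (c 0 : ℂ) := by simp; ring
      rw [this, Complex.norm_real, Real.norm_eq_abs, abs_of_nonneg h0]
      linarith
    | succ m ih =>
      intro hm
      have h1 := ih (by omega)
      have h2 := hc m (by omega)
      have : (1 - z) * (∑ k ∈ Finset.range (m + 1 + 1), (c k : ℂ) * z ^ k)
          + c (m + 1) * z ^ (m + 1 + 1)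
          = ((1 - z) * (∑ k ∈ Finset.range (m + 1), (c k : ℂ) * z ^ k)
          + c m * z ^ (m + 1)) + ((c (m + 1) - c m : ℝ) : ℂ) * z ^ (m + 1) := by
        rw [Finset.sum_range_succ _ (m + 1)]
        push_cast
        ring
      rw [this]
      refine (norm_add_le _ _).trans ?_
      rw [norm_mul, norm_pow, hz, one_pow, mul_one, Complex.norm_real, Real.norm_eq_abs,
        abs_of_nonpos (by linarith)]
      linarith
  have h1 := key M le_rfl
  have h2 : ‖(c M : ℂ) * z ^ (M + 1)‖ = c M := by
    rw [norm_mul, norm_pow, hz, one_pow, mul_one, Complex.norm_real, Real.norm_eq_abs,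
      abs_of_nonneg (hc0 M (by omega))]
  have h3 := norm_sub_le ((1 - z) * (∑ k ∈ Finset.range (M + 1), (c k : ℂ) * z ^ k)
      + c M * z ^ (M + 1)) ((c M : ℂ) * z ^ (M + 1))
  rw [add_sub_cancel_right, h2] at h3
  linarith

/-- Jordan's inequality for the sine at |x|/2, as |1 - e^{ix}| = 2 |sin(x/2)|. -/
theorem abs_le_norm_one_sub_exp {x : ℝ} (hx : |x| ≤ Real.pi) :
    2 / Real.pi * |x| ≤ ‖1 - Complex.exp (Complex.I * x)‖ := by
  rw [norm_sub_rev, Complex.norm_exp_I_mul_ofReal_sub_one]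
  have h1 := Real.mul_le_sin (x := |x| / 2) (by positivity) (by linarith)
  have h2 : ‖2 * Real.sin (x / 2)‖ = 2 * |Real.sin (x / 2)| := by
    rw [norm_mul]; simp
  rw [h2]
  have h3 : |Real.sin (x / 2)| = |Real.sin (|x| / 2)| := by
    rcases abs_cases x with ⟨h, _⟩ | ⟨h, _⟩ <;> rw [h]
    rw [neg_div, Real.sin_neg, abs_neg]
  rw [h3]
  have := le_abs_self (Real.sin (|x| / 2))
  calc 2 / Real.pi * |x| = 2 * (2 / Real.pi * (|x| / 2)) := by ring
    _ ≤ _ := by linarith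

theorem fourier_natCast_coe (k : ℕ) (x : ℝ) :
    fourier (k : ℤ) (x : Circle2Pi) = Complex.exp (Complex.I * x) ^ k := by
  rw [fourier_coe_apply, ← Complex.exp_nat_mul]
  congr 1
  have : (Real.pi : ℂ) ≠ 0 := by exact_mod_cast Real.pi_ne_zero
  push_cast
  field_simp

theorem norm_fourier_apply (k : ℤ) (x : Circle2Pi) : ‖(fourier k x : ℂ)‖ = 1 := by
  rw [fourier_apply]; exact Circle.norm_coe _

/-- Pointwise bound of a cosine-type sum with nonincreasing coefficients. -/
theorem abs_mul_norm_sum_antitone_le {x : ℝ} (hx : |x| ≤ Real.pi) (c : ℕ → ℝ) (m M : ℕ)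
    (hc0 : ∀ k, m ≤ k → 0 ≤ c k) (hc : ∀ k, m ≤ k → c (k + 1) ≤ c k) :
    |x| * ‖∑ k ∈ Finset.Ico m M, (c k : ℂ) * fourier (k : ℤ) (x : Circle2Pi)‖
      ≤ Real.pi * c m := by
  set z := Complex.exp (Complex.I * x) with hz
  have hz1 : ‖z‖ = 1 := by rw [hz, mul_comm]; exact Complex.norm_exp_ofReal_mul_I x
  have e1 : ∑ k ∈ Finset.Ico m M, (c k : ℂ) * fourier (k : ℤ) (x : Circle2Pi)
      = z ^ m * ∑ k ∈ Finset.range (M - m), (c (m + k) : ℂ) * z ^ k := by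
    rw [Finset.sum_Ico_eq_sum_range, Finset.mul_sum]
    refine Finset.sum_congr rfl fun k _ => ?_
    rw [fourier_natCast_coe, pow_add]; ring
  have h1 := norm_one_sub_mul_sum_le z hz1 (fun k => c (m + k)) (M - m)
    (fun k _ => hc0 (m + k) (by omega)) (fun k _ => hc (m + k) (by omega)) (hc0 _ (by omega))
  have h2 := abs_le_norm_one_sub_exp hx
  rw [e1, norm_mul, norm_pow, hz1, one_pow, one_mul]
  rw [norm_mul] at h1
  have h3 := (mul_le_mul_of_nonneg_right h2 (norm_nonneg
    (∑ k ∈ Finset.range (M - m), (c (m + k) : ℂ) * z ^ k))).trans h1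
  have hpi := Real.pi_pos
  rw [div_mul_eq_mul_div, div_mul_eq_mul_div, div_le_iff₀ hpi] at h3
  simp only [add_zero] at h3
  nlinarith

/-- Pointwise bound of a cosine-type sum with nondecreasing coefficients. -/
theorem abs_mul_norm_sum_monotone_le {x : ℝ} (hx : |x| ≤ Real.pi) (c : ℕ → ℝ) (N : ℕ)
    (hc0 : ∀ k, 1 ≤ k → 0 ≤ c k) (hc : ∀ k, 1 ≤ k → c k ≤ c (k + 1)) (hN : 1 ≤ N) :
    |x| * ‖∑ k ∈ Finset.Ico 1 (N + 1), (c k : ℂ) * fourier (k : ℤ) (x : Circle2Pi)‖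
      ≤ Real.pi * c N := by
  set z := Complex.exp (Complex.I * x) with hz
  have hz1 : ‖z‖ = 1 := by rw [hz, mul_comm]; exact Complex.norm_exp_ofReal_mul_I x
  have hz0 : z ≠ 0 := by intro h; rw [h] at hz1; simp at hz1
  -- Read backwards, the sum is z ^ N times a power sum in z⁻¹ with nonincreasing coefficients.
  have e1 : ∑ k ∈ Finset.Ico 1 (N + 1), (c k : ℂ) * fourier (k : ℤ) (x : Circle2Pi)
      = z ^ N * ∑ k ∈ Finset.range N, (c (N - k) : ℂ) * z⁻¹ ^ k := by
    rw [Finset.sum_Ico_eq_sum_range, Finset.mul_sum, Nat.add_sub_cancel,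
      ← Finset.sum_range_reflect]
    refine Finset.sum_congr rfl fun k hk => ?_
    have hk' := Finset.mem_range.1 hk
    have e : 1 + (N - 1 - k) = N - k := by omega
    rw [fourier_natCast_coe, e, inv_pow, ← hz]
    have : z ^ N = z ^ (N - k) * z ^ k := by rw [← pow_add]; congr 1; omega
    rw [this]
    field_simp
  have h1 := norm_one_sub_mul_sum_le z⁻¹ (by rw [norm_inv, hz1, inv_one]) (fun k => c (N - k)) N
    (fun k hk => hc0 _ (by omega)) (fun k hk => by
      have := hc (N - (k + 1)) (by omega)
      rwa [show N - (k + 1) + 1 = N - k by omega] at this) (hc0 _ (by omega))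
  have h2 := abs_le_norm_one_sub_exp hx
  have h4 : ‖1 - z⁻¹‖ = ‖1 - z‖ := by
    have : 1 - z⁻¹ = -(z⁻¹ * (1 - z)) := by field_simp; ring
    rw [this, norm_neg, norm_mul, norm_inv, hz1, inv_one, one_mul]
  rw [e1, norm_mul, norm_pow, hz1, one_pow, one_mul]
  rw [norm_mul, h4] at h1
  have h3 := (mul_le_mul_of_nonneg_right h2 (norm_nonneg
    (∑ k ∈ Finset.range N, (c (N - k) : ℂ) * z⁻¹ ^ k))).trans h1
  have hpi := Real.pi_pos
  rw [div_mul_eq_mul_div, div_mul_eq_mul_div, div_le_iff₀ hpi] at h3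
  simp only [Nat.sub_zero] at h3
  nlinarith

/-! ### Norm of a peaked kernel -/

/-- The constant `∫ (1 + |x|)^{-q} dx`. -/
noncomputable def tailConst (q : ℝ) : ℝ≥0∞ :=
  ∫⁻ x : ℝ, ENNReal.ofReal ((1 + ‖x‖) ^ (-q))

theorem tailConst_lt_top {q : ℝ} (hq : 1 < q) : tailConst q < ⊤ :=
  finite_integral_one_add_norm (by simpa using hq)

theorem lintegral_scaled_tail {q a : ℝ} (ha : 0 < a) :
    ∫⁻ x : ℝ, ENNReal.ofReal ((1 + ‖a * x‖) ^ (-q)) = ENNReal.ofReal a⁻¹ * tailConst q := by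
  have h := (Measurable.ennreal_ofReal (f := fun x : ℝ => (1 + ‖x‖) ^ (-q))
    (by fun_prop))
  have h2 := lintegral_map (μ := (volume : Measure ℝ)) h (measurable_const_mul a)
  rw [Real.map_volume_mul_left ha.ne', lintegral_smul_measure, abs_of_pos (inv_pos.2 ha)] at h2
  rw [← h2]; rfl

/-- The `L_q` norm of a function on the circle bounded by `B min(a, 1/|x|)`. -/
theorem eLpNorm_le_of_peak {q a B : ℝ} (hq : 1 < q) (ha : 0 < a) (hB : 0 ≤ B)
    (G : Circle2Pi → ℂ) (h1 : ∀ x : ℝ, |x| ≤ Real.pi → ‖G x‖ ≤ B * a)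
    (h2 : ∀ x : ℝ, |x| ≤ Real.pi → |x| * ‖G x‖ ≤ B) :
    eLpNorm G (ENNReal.ofReal q) volume
      ≤ ENNReal.ofReal (2 * B * a ^ (1 - 1 / q)) * (tailConst q) ^ (1 / q) := by
  have hq0 : 0 < q := by linarith
  rw [eLpNorm_eq_lintegral_rpow_enorm_toReal (by simpa using hq0) ENNReal.ofReal_ne_top,
    ENNReal.toReal_ofReal hq0.le]
  have hb : ∀ x : ℝ, |x| ≤ Real.pi →
      ‖G x‖ₑ ^ q ≤ ENNReal.ofReal ((2 * B * a) ^ q) *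
        ENNReal.ofReal ((1 + ‖a * x‖) ^ (-q)) := by
    intro x hx
    have hp : (0 : ℝ) < 1 + ‖a * x‖ := by positivity
    -- The first hypothesis plus a times the second bounds ‖G x‖ (1 + a|x|) by 2Ba.
    have : ‖G x‖ ≤ 2 * B * a * (1 + ‖a * x‖)⁻¹ := by
      rw [← div_eq_mul_inv, le_div_iff₀ hp, norm_mul, Real.norm_eq_abs, Real.norm_eq_abs,
        abs_of_pos ha]
      have i1 := h1 x hx
      have i2 := mul_le_mul_of_nonneg_left (h2 x hx) ha.le
      nlinarith
    rw [← ENNReal.ofReal_mul (by positivity), Real.rpow_neg hp.le, ← Real.inv_rpow hp.le,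
      ← Real.mul_rpow (by positivity) (by positivity), ← ofReal_norm,
      ENNReal.ofReal_rpow_of_nonneg (norm_nonneg _) hq0.le]
    exact ENNReal.ofReal_le_ofReal (Real.rpow_le_rpow (norm_nonneg _) this hq0.le)
  have hint : ∫⁻ x : Circle2Pi, ‖G x‖ₑ ^ q ≤
      ENNReal.ofReal ((2 * B * a) ^ q) * (ENNReal.ofReal a⁻¹ * tailConst q) := by
    rw [← AddCircle.lintegral_preimage (2 * Real.pi) (-Real.pi), ← lintegral_scaled_tail ha,
      ← lintegral_const_mul' _ _ ENNReal.ofReal_ne_top]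
    refine (setLIntegral_mono' measurableSet_Ioc fun x hx => hb x ?_).trans
      (setLIntegral_le_lintegral _ _)
    rw [abs_le]; constructor <;> linarith [hx.1, hx.2]
  calc (∫⁻ x : Circle2Pi, ‖G x‖ₑ ^ q) ^ (1 / q)
      ≤ (ENNReal.ofReal ((2 * B * a) ^ q) * (ENNReal.ofReal a⁻¹ * tailConst q)) ^ (1 / q) :=
        ENNReal.rpow_le_rpow hint (by positivity)
    _ = _ := by
      rw [← mul_assoc, ENNReal.mul_rpow_of_nonneg _ _ (by positivity),
        ← ENNReal.ofReal_mul (by positivity),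
        ENNReal.ofReal_rpow_of_nonneg (by positivity) (by positivity)]
      congr 2
      rw [Real.mul_rpow (by positivity) (by positivity), ← Real.rpow_mul (by positivity),
        mul_one_div_cancel hq0.ne', Real.rpow_one, Real.rpow_sub ha, Real.rpow_one,
        Real.inv_rpow ha.le]
      ring

/-! ### Halving intervals and tail sums of ψ -/

variable {ψ : ℝ → ℝ}

/-- A rise from x to y followed by the eventual descent towards 0 would give a positive slope before
a negative one, against convexity. -/
theorem MemM.antitoneOn (h : MemM ψ) : AntitoneOn ψ (Set.Ici 1) := by
  intro x hx y hy hxy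
  by_contra! hlt
  have hxy' : x < y := lt_of_le_of_ne hxy (by rintro rfl; exact lt_irrefl _ hlt)
  have hev := (h.lim.eventually (gt_mem_nhds (h.pos y hy))).and (eventually_gt_atTop y)
  obtain ⟨z, hz, hyz⟩ := hev.exists
  have hx1 : (1 : ℝ) ≤ x := hx
  have hs := h.convex.slope_mono_adjacent hx (show z ∈ Set.Ici (1 : ℝ) by
    simp only [Set.mem_Ici]; linarith) hxy' hyz
  have h1 : 0 < (ψ y - ψ x) / (y - x) := div_pos (by linarith) (by linarith)
  have h2 : (ψ z - ψ y) / (z - y) < 0 := div_neg_of_neg_of_pos (by linarith) (by linarith)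
  linarith

/-- The half value is attained by the intermediate value theorem, so the chosen inverse takes no
default value here. -/
theorem MemM.eta_spec (h : MemM ψ) {t : ℝ} (ht : 1 ≤ t) :
    1 ≤ eta ψ t ∧ ψ (eta ψ t) = ψ t / 2 := by
  have hp := h.pos t ht
  have hev := (h.lim.eventually (gt_mem_nhds (half_pos hp))).and (eventually_ge_atTop t)
  obtain ⟨z, hz, htz⟩ := hev.exists
  have hmem : ψ t / 2 ∈ ψ '' Set.Ici 1 := by
    have := intermediate_value_Icc' htz (h.cont.mono fun x hx => ht.trans hx.1)
    obtain ⟨s, hs, hs'⟩ := this ⟨hz.le, by linarith⟩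
    exact ⟨s, ht.trans hs.1, hs'⟩
  exact ⟨Function.invFunOn_mem hmem, Function.invFunOn_eq hmem⟩

/-- Halving takes a length of at least K, so each step of length K costs at most a factor 2. -/
theorem MemM.half_le_of_le_eta (h : MemM ψ) {K : ℝ} (hK0 : 0 < K)
    (hK : ∀ t, 1 ≤ t → K ≤ eta ψ t - t) {t : ℝ} (ht : 1 ≤ t) (j : ℕ) :
    ψ t / 2 ^ j ≤ ψ (t + j * K) := by
  induction j with
  | zero => simp
  | succ j ih =>
    have hs : 1 ≤ t + j * K := by
      have : 0 ≤ (j : ℝ) * K := by positivity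
      linarith
    have h1 := (h.eta_spec hs)
    have h2 := h.antitoneOn (show t + (j + 1 : ℕ) * K ∈ Set.Ici (1 : ℝ) by
      simp only [Set.mem_Ici]; push_cast; nlinarith) h1.1
      (by push_cast; linarith [hK _ hs])
    rw [h1.2] at h2
    rw [pow_succ, ← div_div]
    linarith

/-- `∑_{t < k < M} ψ(k) ≪ ψ(t) (η(t) - t)` far out. -/
theorem sum_filter_lt_le (h : MemM ψ) {K t₀ : ℝ} (hK0 : 0 < K)
    (hK : ∀ t, 1 ≤ t → K ≤ eta ψ t - t) (ht₀ : 1 ≤ t₀)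
    (hgrow : ∀ t, t₀ ≤ t → eta ψ (eta ψ t) - eta ψ t ≤ 5 / 4 * (eta ψ t - t)) (M : ℕ) (j : ℕ) :
    ∀ t, t₀ ≤ t → (M : ℝ) - t ≤ j * K →
      ∑ k ∈ (Finset.range M).filter (fun k : ℕ => t < k), ψ k ≤
        8 / 3 * (1 + 1 / K) * (ψ t * (eta ψ t - t)) := by
  -- Passing from t to η(t) advances by at least K, so j bounds the number of halving intervals
  -- needed to reach M.
  induction j with
  | zero =>
    intro t ht hM
    rw [Finset.sum_eq_zero]
    · have := h.pos t (ht₀.trans ht)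
      have := hK t (ht₀.trans ht)
      have : 0 ≤ eta ψ t - t := by linarith
      positivity
    · intro k hk
      exfalso
      simp only [Finset.mem_filter, Finset.mem_range] at hk
      have h1 : (k : ℝ) < M := by exact_mod_cast hk.1
      simp at hM
      linarith [hk.2]
  | succ j ih =>
    intro t ht hM
    have ht1 := ht₀.trans ht
    have hp := h.pos t ht1
    have ha := hK t ht1
    have hη := h.eta_spec ht1
    set s := eta ψ t with hs
    have hIH := ih s (by linarith) (by push_cast at hM; nlinarith)
    rw [hη.2] at hIH
    have hg := hgrow t ht
    rw [← hs] at hg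
    have hsplit : ∑ k ∈ (Finset.range M).filter (fun k : ℕ => t < k), ψ k ≤
        ∑ k ∈ Finset.Ioc ⌊t⌋₊ ⌊s⌋₊, ψ k +
          ∑ k ∈ (Finset.range M).filter (fun k : ℕ => s < k), ψ k := by
      rw [← Finset.sum_union]
      · refine Finset.sum_le_sum_of_subset_of_nonneg ?_ ?_
        · intro k hk
          simp only [Finset.mem_filter, Finset.mem_range, Finset.mem_union, Finset.mem_Ioc] at hk ⊢
          by_cases hks : s < k
          · exact Or.inr ⟨hk.1, hks⟩
          · exact Or.inl ⟨(Nat.floor_lt (by linarith)).2 hk.2, Nat.le_floor (not_lt.1 hks)⟩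
        · intro k hk _
          simp only [Finset.mem_filter, Finset.mem_range, Finset.mem_union, Finset.mem_Ioc] at hk
          rcases hk with hk | hk
          · have := (Nat.floor_lt (by linarith)).1 hk.1
            exact (h.pos _ (by linarith)).le
          · exact (h.pos _ (by linarith)).le
      · rw [Finset.disjoint_left]
        intro k hk hk'
        simp only [Finset.mem_filter, Finset.mem_range, Finset.mem_Ioc] at hk hk'
        have := (Nat.le_floor_iff (by linarith)).1 hk.2
        linarith [hk'.2]
    have hfirst : ∑ k ∈ Finset.Ioc ⌊t⌋₊ ⌊s⌋₊, ψ k ≤ (s - t + 1) * ψ t := by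
      have h1 : ∑ k ∈ Finset.Ioc ⌊t⌋₊ ⌊s⌋₊, ψ k ≤ ∑ k ∈ Finset.Ioc ⌊t⌋₊ ⌊s⌋₊, ψ t := by
        refine Finset.sum_le_sum fun k hk => ?_
        have := (Nat.floor_lt (by linarith)).1 (Finset.mem_Ioc.1 hk).1
        exact h.antitoneOn ht1 (show (1 : ℝ) ≤ k by linarith) this.le
      refine h1.trans ?_
      rw [Finset.sum_const, nsmul_eq_mul, Nat.card_Ioc]
      refine mul_le_mul_of_nonneg_right ?_ hp.le
      rw [Nat.cast_sub (Nat.floor_mono (by linarith))]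
      have h2 := Nat.floor_le (show 0 ≤ s by linarith)
      have h3 := Nat.lt_floor_add_one t
      linarith
    -- The extra 1 from counting integers in an interval is absorbed because s - t ≥ K.
    have hone : 1 ≤ 1 / K * (s - t) := by
      rw [one_div, ← div_eq_inv_mul, le_div_iff₀ hK0]; linarith
    set L := 1 / K with hL
    have hL0 : 0 < L := by positivity
    have e1 : (s - t + 1) * ψ t ≤ (1 + L) * (ψ t * (s - t)) := by nlinarith
    -- Here ψ halves while the interval grows by at most 5/4: the ratio is 5/8, and 8/3 = 1/(1 -
    -- 5/8).
    have e2 : 8 / 3 * (1 + L) * (ψ t / 2 * (eta ψ s - s)) ≤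
        8 / 3 * (1 + L) * (ψ t / 2 * (5 / 4 * (s - t))) := by gcongr
    nlinarith

/-- The tails of `∑ ψ(k)` are of order at most `ψ(n) (η(n) - n)`. -/
theorem exists_sum_Ico_le (h : MemMTwo ψ) :
    ∃ C : ℝ, 0 < C ∧ ∀ n : ℕ, 1 ≤ n → ∀ M : ℕ,
      ∑ k ∈ Finset.Ico n M, ψ k ≤ C * (ψ n * (eta ψ n - n)) := by
  obtain ⟨K, hK0, hK⟩ := h.eta_sub_ge
  have hM := h.toMemM
  obtain ⟨⟨t₁, hmono⟩, htop⟩ := h.mu_increases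
  -- From μ(t) ≥ 4 follows η(t) ≤ 5t/4, and monotonicity of μ then bounds the next interval by 5/4
  -- of the present one. Any factor below 2 would do.
  obtain ⟨t₂, ht₂⟩ := eventually_atTop.1 (htop.eventually_ge_atTop 4)
  set T : ℕ := ⌈max 1 (max t₁ t₂)⌉₊ with hT
  have hT' : max 1 (max t₁ t₂) ≤ T := Nat.le_ceil _
  have hT1 : (1 : ℝ) ≤ T := (le_max_left _ _).trans hT'
  have hTt1 : t₁ ≤ T := ((le_max_left _ _).trans (le_max_right _ _)).trans hT'
  have hTt2 : t₂ ≤ T := ((le_max_right _ _).trans (le_max_right _ _)).trans hT'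
  have hgrow : ∀ t, (T : ℝ) ≤ t → eta ψ (eta ψ t) - eta ψ t ≤ 5 / 4 * (eta ψ t - t) := by
    intro t ht
    have ht1 := hT1.trans ht
    have hs1 := (hM.eta_spec ht1).1
    have ha := hK t ht1
    have hb := hK _ hs1
    have hm : mu ψ t ≤ mu ψ (eta ψ t) :=
      hmono (show t₁ ≤ t by linarith) (show t₁ ≤ eta ψ t by linarith) (by linarith)
    have h4 := ht₂ t (by linarith)
    unfold mu at hm h4
    set s := eta ψ t with hs
    rw [le_div_iff₀ (by linarith)] at h4
    rw [div_le_div_iff₀ (by linarith) (by linarith)] at hm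
    by_contra! hc
    have : t * (5 / 4 * (s - t)) < t * (eta ψ s - s) := mul_lt_mul_of_pos_left hc (by linarith)
    nlinarith
  have hsum := fun M j => sum_filter_lt_le hM hK0 hK hT1 hgrow M j
  set B := 8 / 3 * (1 + 1 / K) with hB
  have hB0 : 0 < B := by positivity
  have hbig : ∀ n : ℕ, T ≤ n → ∀ M : ℕ,
      ∑ k ∈ Finset.Ico n M, ψ k ≤ (B + 1 / K) * (ψ n * (eta ψ n - n)) := by
    intro n hn M
    have hn' : (T : ℝ) ≤ n := by exact_mod_cast hn
    have hp := hM.pos n (hT1.trans hn')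
    have ha := hK n (hT1.trans hn')
    obtain ⟨j, hj⟩ := exists_nat_ge (((M : ℝ) - n) / K)
    rw [div_le_iff₀ hK0] at hj
    have h1 := hsum M j n hn' hj
    have h2 : ∑ k ∈ Finset.Ico n M, ψ k ≤
        ψ n + ∑ k ∈ (Finset.range M).filter (fun k : ℕ => (n : ℝ) < k), ψ k := by
      rw [← Finset.sum_insert (f := fun k : ℕ => ψ k) (a := n) (by simp)]
      refine Finset.sum_le_sum_of_subset_of_nonneg ?_ ?_
      · intro k hk
        simp only [Finset.mem_Ico, Finset.mem_insert, Finset.mem_filter, Finset.mem_range,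
          Nat.cast_lt] at hk ⊢
        omega
      · intro k hk _
        simp only [Finset.mem_insert, Finset.mem_filter, Finset.mem_range, Nat.cast_lt] at hk
        have : T ≤ k := by omega
        have : (T : ℝ) ≤ k := by exact_mod_cast this
        exact (hM.pos _ (by linarith)).le
    have h3 : ψ n ≤ 1 / K * (ψ n * (eta ψ n - n)) := by
      rw [one_div, ← div_eq_inv_mul, le_div_iff₀ hK0]; gcongr
    linarith
  have haT := hK T hT1
  -- The last summand serves n < T: the terms before T are at most ψ(n) each, the others are
  -- controlled at T, and a/K ≥ 1 restores the factor a.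
  refine ⟨B + 1 / K + (T + (B + 1 / K) * (eta ψ T - T)) / K, by
    have : 0 < eta ψ T - T := by linarith
    positivity, fun n hn M => ?_⟩
  have hn1 : (1 : ℝ) ≤ n := by exact_mod_cast hn
  have hp := hM.pos n hn1
  have ha := hK n hn1
  have haT0 : 0 < eta ψ T - T := by linarith
  have hq : 0 ≤ (T + (B + 1 / K) * (eta ψ T - T)) / K := by positivity
  have ha0 : 0 < eta ψ n - n := by linarith
  rw [add_mul]
  by_cases hTn : T ≤ n
  · have := hbig n hTn M
    have : 0 ≤ (T + (B + 1 / K) * (eta ψ T - T)) / K * (ψ n * (eta ψ n - n)) := by positivity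
    linarith
  · push Not at hTn
    have h1 : ∑ k ∈ Finset.Ico n M, ψ k ≤
        ∑ k ∈ Finset.Ico n T, ψ k + ∑ k ∈ Finset.Ico T M, ψ k := by
      rw [← Finset.sum_union (Finset.disjoint_left.2 fun k hk hk' => by
        simp only [Finset.mem_Ico] at hk hk'; omega)]
      refine Finset.sum_le_sum_of_subset_of_nonneg ?_ ?_
      · intro k hk
        simp only [Finset.mem_Ico, Finset.mem_union] at hk ⊢
        omega
      · intro k hk _
        simp only [Finset.mem_Ico, Finset.mem_union] at hk
        have : 1 ≤ k := by omega
        exact (hM.pos _ (by exact_mod_cast this)).le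
    have h2 : ∑ k ∈ Finset.Ico n T, ψ k ≤ T * ψ n := by
      have : ∑ k ∈ Finset.Ico n T, ψ k ≤ ∑ k ∈ Finset.Ico n T, ψ n := by
        refine Finset.sum_le_sum fun k hk => ?_
        have := (Finset.mem_Ico.1 hk).1
        have hk1 : 1 ≤ k := by omega
        exact hM.antitoneOn hn1 (show (1 : ℝ) ≤ k by exact_mod_cast hk1) (by exact_mod_cast this)
      refine this.trans ?_
      rw [Finset.sum_const, nsmul_eq_mul, Nat.card_Ico]
      gcongr
      omega
    have h3 := hbig T le_rfl M
    have h4 : ψ T ≤ ψ n := hM.antitoneOn hn1 hT1 (by exact_mod_cast hTn.le)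
    have h5 : (B + 1 / K) * (ψ T * (eta ψ T - T)) ≤ (B + 1 / K) * (ψ n * (eta ψ T - T)) := by
      gcongr
    have h6 : (T + (B + 1 / K) * (eta ψ T - T)) * ψ n ≤
        (T + (B + 1 / K) * (eta ψ T - T)) / K * (ψ n * (eta ψ n - n)) := by
      rw [div_mul_eq_mul_div, le_div_iff₀ hK0, mul_assoc]
      gcongr
    have h7 : 0 ≤ (B + 1 / K) * (ψ n * (eta ψ n - n)) := by positivity
    linarith

/-! ### Supporting lines and sums of 1/ψ -/

/-- The line through (t, ψ(t)) with slope the right derivative supports a convex function; that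
slope is nonpositive, whence the signs in front of the absolute value. -/
theorem MemM.rightDeriv_slopes (h : MemM ψ) {t : ℝ} (ht : 1 < t) :
    (∀ s, t < s → ψ t - |rightDeriv ψ t| * (s - t) ≤ ψ s) ∧
      (∀ s, 1 ≤ s → s < t → ψ t + |rightDeriv ψ t| * (t - s) ≤ ψ s) := by
  have hint : t ∈ interior (Set.Ici (1 : ℝ)) := by rw [interior_Ici]; exact ht
  have h1 : ∀ s, t < s → rightDeriv ψ t ≤ (ψ s - ψ t) / (s - t) := fun s hs => by
    have := h.convex.rightDeriv_le_slope_of_mem_interior hint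
      (show s ∈ Set.Ici (1 : ℝ) from (ht.trans hs).le) hs
    rwa [slope_def_field] at this
  have hneg : rightDeriv ψ t ≤ 0 := by
    refine (h1 (t + 1) (by linarith)).trans ?_
    have := h.antitoneOn (show t ∈ Set.Ici (1 : ℝ) from ht.le)
      (show t + 1 ∈ Set.Ici (1 : ℝ) by simp only [Set.mem_Ici]; linarith) (by linarith)
    simpa using this
  rw [abs_of_nonpos hneg]
  constructor
  · intro s hs
    have := h1 s hs
    rw [le_div_iff₀ (by linarith)] at this
    linarith
  · intro s hs1 hs
    have h2 := (h.convex.slope_le_leftDeriv_of_mem_interior (show s ∈ Set.Ici (1 : ℝ) from hs1)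
      hint hs).trans (h.convex.leftDeriv_le_rightDeriv_of_mem_interior hint)
    rw [slope_def_field, div_le_iff₀ (by linarith)] at h2
    unfold rightDeriv
    linarith

/-- Sums of `1 / ψ` are of order at most `(η(n) - n) / ψ(n)`. -/
theorem exists_sum_inv_le (h : MemMTwo ψ)
    (h' : IncreasesToInfinity (fun t => ψ t / |rightDeriv ψ t|)) :
    ∃ C : ℝ, 0 < C ∧ ∀ n : ℕ, 1 ≤ n → ψ n / ψ ⌈eta ψ n⌉₊ ≤ C ∧
      ∑ k ∈ Finset.Ico 1 (⌈eta ψ n⌉₊ + 1), ψ n / ψ k ≤ C * (eta ψ n - n) := by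
  obtain ⟨K, hK0, hK⟩ := h.eta_sub_ge
  have hM := h.toMemM
  obtain ⟨⟨t₁, hmono⟩, htop⟩ := h'
  obtain ⟨t₂, ht₂⟩ := eventually_atTop.1 (htop.eventually_gt_atTop 0)
  -- The 2 keeps all points used for supporting lines in the interior of [1, ∞).
  set T : ℕ := ⌈max 2 (max t₁ t₂)⌉₊ with hT
  have hT' : max 2 (max t₁ t₂) ≤ T := Nat.le_ceil _
  have hT1 : (2 : ℝ) ≤ T := (le_max_left _ _).trans hT'
  have hTt1 : t₁ ≤ T := ((le_max_left _ _).trans (le_max_right _ _)).trans hT'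
  have hTt2 : t₂ ≤ T := ((le_max_right _ _).trans (le_max_right _ _)).trans hT'
  have hhead : ∀ n : ℕ, 1 ≤ n → ∀ m ≤ n, ∑ k ∈ Finset.Ico 1 m, ψ n / ψ k ≤ m := by
    intro n hn m hm
    have : ∑ k ∈ Finset.Ico 1 m, ψ n / ψ k ≤ ∑ k ∈ Finset.Ico 1 m, (1 : ℝ) := by
      refine Finset.sum_le_sum fun k hk => ?_
      rw [Finset.mem_Ico] at hk
      have hk1 : (1 : ℝ) ≤ k := by exact_mod_cast hk.1
      rw [div_le_one (hM.pos k hk1)]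
      have hkn : (k : ℝ) ≤ n := by exact_mod_cast (hk.2.le.trans hm)
      exact hM.antitoneOn hk1 (hk1.trans hkn) hkn
    refine this.trans ?_
    simp
  have hmid : ∀ n : ℕ, T ≤ n → ∑ k ∈ Finset.Ico T n, ψ n / ψ k ≤ 2 * (eta ψ n - n) := by
    intro n hn
    have hn' : (T : ℝ) ≤ n := by exact_mod_cast hn
    set g : ℝ := ψ n / |rightDeriv ψ n| with hg
    have hg0 : 0 < g := ht₂ n (by linarith)
    have hp := hM.pos n (by linarith)
    -- A zero derivative would make the quotient 0 by the convention for division, contrary to its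
    -- eventual positivity.
    have hd0 : 0 < |rightDeriv ψ n| := by
      by_contra! hc
      have : |rightDeriv ψ n| = 0 := le_antisymm hc (abs_nonneg _)
      rw [hg, this, div_zero] at hg0
      exact lt_irrefl _ hg0
    -- The supporting line at n, read at η(n), where ψ has fallen by ψ(n)/2.
    have hga : g ≤ 2 * (eta ψ n - n) := by
      have h1 := (hM.rightDeriv_slopes (show (1 : ℝ) < n by linarith)).1 (eta ψ n)
        (by linarith [hK n (by linarith)])
      rw [(hM.eta_spec (show (1 : ℝ) ≤ n by linarith)).2] at h1
      rw [hg, div_le_iff₀ hd0]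
      linarith
    -- The supporting line at k + 1 and monotonicity of ψ/|ψ'| give g(ψ(k) - ψ(k+1)) ≥ g|ψ'(k+1)| ≥
    -- ψ(k+1). Division by ψ(k)ψ(k+1) yields a telescoping bound.
    have hstep : ∀ k : ℕ, T ≤ k → k + 1 ≤ n → 1 / ψ k ≤ g * (1 / ψ (k + 1 : ℕ) - 1 / ψ k) := by
      intro k hk hkn
      have hk' : (T : ℝ) ≤ k := by exact_mod_cast hk
      have hkn' : ((k + 1 : ℕ) : ℝ) ≤ n := by exact_mod_cast hkn
      have hk1 : ((k + 1 : ℕ) : ℝ) = k + 1 := by push_cast; ring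
      have h1 := (hM.rightDeriv_slopes (show (1 : ℝ) < (k + 1 : ℕ) by linarith)).2 k
        (by linarith) (by linarith)
      have h2 : ψ (k + 1 : ℕ) / |rightDeriv ψ (k + 1 : ℕ)| ≤ g :=
        hmono (show t₁ ≤ ((k + 1 : ℕ) : ℝ) by linarith) (show t₁ ≤ (n : ℝ) by linarith) hkn'
      have h3 : 0 < ψ (k + 1 : ℕ) / |rightDeriv ψ (k + 1 : ℕ)| := ht₂ _ (by linarith)
      have hp1 := hM.pos (k + 1 : ℕ) (by linarith)
      have hp0 := hM.pos k (by linarith)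
      have hd : 0 < |rightDeriv ψ (k + 1 : ℕ)| := by
        by_contra! hc
        have : |rightDeriv ψ (k + 1 : ℕ)| = 0 := le_antisymm hc (abs_nonneg _)
        rw [this, div_zero] at h3
        exact lt_irrefl _ h3
      rw [div_le_iff₀ hd] at h2
      have h4 : ((k + 1 : ℕ) : ℝ) - k = 1 := by rw [hk1]; ring
      rw [h4, mul_one] at h1
      rw [div_sub_div _ _ hp1.ne' hp0.ne', ← mul_div_assoc, div_le_div_iff₀ hp0 (by positivity)]
      nlinarith [mul_le_mul_of_nonneg_left h1 hg0.le, mul_pos hp0 hp1]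
    have hind : ∀ m : ℕ, T ≤ m → m ≤ n → ∑ k ∈ Finset.Ico T m, 1 / ψ k ≤
        g * (1 / ψ m - 1 / ψ T) := by
      intro m hm
      induction m, hm using Nat.le_induction with
      | base => intro _; simp
      | succ m hm ih =>
        intro hmn
        rw [Finset.sum_Ico_succ_top hm]
        have := ih (by omega)
        have := hstep m hm hmn
        linarith
    have h1 := hind n hn le_rfl
    have hpT := hM.pos T (by linarith)
    have h2 : ∑ k ∈ Finset.Ico T n, ψ n / ψ k = ψ n * ∑ k ∈ Finset.Ico T n, 1 / ψ k := by
      rw [Finset.mul_sum]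
      exact Finset.sum_congr rfl fun k _ => by ring
    rw [h2]
    refine le_trans ?_ hga
    refine (mul_le_mul_of_nonneg_left h1 hp.le).trans ?_
    have : ψ n * (g * (1 / ψ n - 1 / ψ T)) = g - ψ n * g * (1 / ψ T) := by field_simp
    rw [this]
    have : 0 ≤ ψ n * g * (1 / ψ T) := by positivity
    linarith
  -- As jK ≥ 1, rounding η(n) up costs at most 2^j; the halving from n to η(n) adds one more factor
  -- 2.
  obtain ⟨j, hj⟩ := exists_nat_ge (1 / K)
  rw [div_le_iff₀ hK0] at hj
  have hlast : ∀ n : ℕ, 1 ≤ n → ψ n / ψ ⌈eta ψ n⌉₊ ≤ 2 ^ (j + 1) := by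
    intro n hn
    have hn1 : (1 : ℝ) ≤ n := by exact_mod_cast hn
    have hη := hM.eta_spec hn1
    have h1 := hM.half_le_of_le_eta hK0 hK hη.1 j
    have h2 : (⌈eta ψ n⌉₊ : ℝ) ≤ eta ψ n + j * K :=
      (Nat.ceil_lt_add_one (by linarith [hη.1])).le.trans (by linarith)
    have h3 : (1 : ℝ) ≤ ⌈eta ψ n⌉₊ := hη.1.trans (Nat.le_ceil _)
    have h4 := hM.antitoneOn h3 (h3.trans h2) h2
    rw [hη.2] at h1
    have h5 := h1.trans h4
    rw [div_le_iff₀ (hM.pos _ h3)]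
    rw [div_div, div_le_iff₀ (by positivity)] at h5
    rw [pow_succ]
    linarith
  refine ⟨2 ^ (j + 1) + (T / K + 2 + (1 + 2 / K) * 2 ^ (j + 1)), by positivity, fun n hn => ?_⟩
  have hn1 : (1 : ℝ) ≤ n := by exact_mod_cast hn
  have ha := hK n hn1
  have hη := hM.eta_spec hn1
  have hp := hM.pos n hn1
  set a := eta ψ n - n with ha'
  have ha0 : 0 < a := by linarith
  set Q : ℝ := 2 ^ (j + 1) with hQ
  have hQ0 : 0 < Q := by positivity
  constructor
  · have h1 := hlast n hn
    have : 0 ≤ T / K + 2 + (1 + 2 / K) * Q := by positivity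
    linarith
  set N := ⌈eta ψ n⌉₊ with hN
  have hnN : n ≤ N := by
    have : (n : ℝ) ≤ N := by linarith [Nat.le_ceil (eta ψ n)]
    exact_mod_cast this
  rw [← Finset.sum_Ico_consecutive _ hn (show n ≤ N + 1 by omega)]
  have hA : ∑ k ∈ Finset.Ico 1 n, ψ n / ψ k ≤ T + 2 * a := by
    rcases le_total n T with hnT | hTn
    · have h1 := hhead n hn n le_rfl
      have h2 : (n : ℝ) ≤ T := by exact_mod_cast hnT
      linarith
    · rw [← Finset.sum_Ico_consecutive _ (show 1 ≤ T by
        have : (1 : ℝ) ≤ T := by linarith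
        exact_mod_cast this) hTn]
      exact add_le_add (hhead n hn T hTn) (hmid n hTn)
  have hB : ∑ k ∈ Finset.Ico n (N + 1), ψ n / ψ k ≤ (a + 2) * Q := by
    have h1 : ∑ k ∈ Finset.Ico n (N + 1), ψ n / ψ k ≤ ∑ k ∈ Finset.Ico n (N + 1), Q := by
      refine Finset.sum_le_sum fun k hk => le_trans ?_ (hlast n hn)
      rw [Finset.mem_Ico] at hk
      have hk1 : (1 : ℝ) ≤ k := by exact_mod_cast hn.trans hk.1
      have hkN : (k : ℝ) ≤ N := by exact_mod_cast Nat.lt_succ_iff.1 hk.2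
      exact div_le_div_of_nonneg_left hp.le (hM.pos _ (hk1.trans hkN))
        (hM.antitoneOn hk1 (hk1.trans hkN) hkN)
    refine h1.trans ?_
    rw [Finset.sum_const, nsmul_eq_mul, Nat.card_Ico, Nat.cast_sub (by omega)]
    have := Nat.ceil_lt_add_one (show 0 ≤ eta ψ n by linarith)
    push_cast
    gcongr
    linarith
  have hone : 1 ≤ a / K := by rw [le_div_iff₀ hK0]; linarith
  have e1 : (T : ℝ) ≤ T * (a / K) := le_mul_of_one_le_right (by positivity) hone
  have e2 : 2 * Q ≤ 2 * Q * (a / K) := le_mul_of_one_le_right (by positivity) hone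
  have e3 : 0 ≤ Q * a := by positivity
  have e4 : (Q + (T / K + 2 + (1 + 2 / K) * Q)) * a =
    Q * a + T * (a / K) + 2 * a + a * Q + 2 * Q * (a / K) := by ring
  rw [e4]
  linarith

/-! ### Uniqueness and pointwise summation of Fourier series -/

open AddCircle

/-- Coefficients use the normalized measure and norms the measure of mass 2π ≥ 1; the domination
lets one pass between them without a constant. -/
theorem haarAddCircle_le_volume : (haarAddCircle : Measure Circle2Pi) ≤ volume := by
  rw [volume_eq_smul_haarAddCircle]
  have h1 : (1 : ℝ≥0∞) ≤ ENNReal.ofReal (2 * Real.pi) := by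
    rw [ENNReal.one_le_ofReal]; linarith [Real.pi_gt_three]
  intro s
  rw [Measure.smul_apply, smul_eq_mul]
  exact le_mul_of_one_le_left' h1

theorem volume_absolutelyContinuous_haarAddCircle :
    (volume : Measure Circle2Pi) ≪ haarAddCircle := by
  rw [volume_eq_smul_haarAddCircle]
  exact Measure.smul_absolutelyContinuous

theorem integrable_haar {E : Type*} [NormedAddCommGroup E] {f : Circle2Pi → E}
    (hf : Integrable f) : Integrable f haarAddCircle :=
  hf.mono_measure haarAddCircle_le_volume

theorem integrable_fourier (k : ℤ) : Integrable (fourier k : Circle2Pi → ℂ) haarAddCircle :=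
  (fourier k).continuous.integrable_of_hasCompactSupport
    (HasCompactSupport.of_compactSpace _)

theorem integrable_continuousMap_mul {u : Circle2Pi → ℂ} (hu : Integrable u haarAddCircle)
    (g : C(Circle2Pi, ℂ)) : Integrable (fun x => g x * u x) haarAddCircle :=
  hu.bdd_mul g.continuous.aestronglyMeasurable (ae_of_all _ g.norm_coe_le_norm)

/-- Integration against an integrable function, as a functional on the continuous functions. -/
noncomputable def pairing {u : Circle2Pi → ℂ} (hu : Integrable u haarAddCircle) :
    C(Circle2Pi, ℂ) →L[ℂ] ℂ :=
  LinearMap.mkContinuous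
    { toFun := fun g => ∫ x, g x * u x ∂haarAddCircle
      map_add' := fun g h => by
        simp only [ContinuousMap.add_apply, add_mul]
        exact integral_add (integrable_continuousMap_mul hu g) (integrable_continuousMap_mul hu h)
      map_smul' := fun c g => by
        simp only [ContinuousMap.smul_apply, smul_eq_mul, mul_assoc, RingHom.id_apply]
        exact integral_const_mul _ _ }
    (∫ x, ‖u x‖ ∂haarAddCircle) (fun g => by
      refine (norm_integral_le_integral_norm _).trans ?_
      refine le_of_le_of_eq (integral_mono (integrable_continuousMap_mul hu g).norm
        (hu.norm.const_mul ‖g‖) ?_) ((integral_const_mul _ _).trans (mul_comm _ _))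
      intro x
      simp only [norm_mul]
      exact mul_le_mul_of_nonneg_right (g.norm_coe_le_norm x) (norm_nonneg _))

theorem pairing_apply {u : Circle2Pi → ℂ} (hu : Integrable u haarAddCircle)
    (g : C(Circle2Pi, ℂ)) : pairing hu g = ∫ x, g x * u x ∂haarAddCircle := rfl

/-- The positive and negative parts of v are densities of two finite measures with the same
integrals of bounded continuous functions, so the measures, and then the densities, coincide. -/
theorem ae_eq_zero_of_forall_integral_mul_eq_zero {v : Circle2Pi → ℝ}
    (hv : Integrable v haarAddCircle)
    (h : ∀ g : BoundedContinuousFunction Circle2Pi ℝ, ∫ x, g x * v x ∂haarAddCircle = 0) :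
    v =ᵐ[haarAddCircle] 0 := by
  have hm1 : AEMeasurable (fun x => ENNReal.ofReal (v x)) haarAddCircle :=
    hv.aemeasurable.ennreal_ofReal
  have hm2 : AEMeasurable (fun x => ENNReal.ofReal (-v x)) haarAddCircle :=
    hv.neg.aemeasurable.ennreal_ofReal
  have hf1 : ∫⁻ x, ENNReal.ofReal (v x) ∂haarAddCircle ≠ ⊤ := hv.lintegral_lt_top.ne
  have hf2 : ∫⁻ x, ENNReal.ofReal (-v x) ∂haarAddCircle ≠ ⊤ := hv.neg.lintegral_lt_top.ne
  have := isFiniteMeasure_withDensity hf1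
  have := isFiniteMeasure_withDensity hf2
  have heq : haarAddCircle.withDensity (fun x => ENNReal.ofReal (v x)) =
      haarAddCircle.withDensity (fun x => ENNReal.ofReal (-v x)) := by
    refine ext_of_forall_integral_eq_of_IsFiniteMeasure fun g => ?_
    have hint : ∀ w : Circle2Pi → ℝ, Integrable w haarAddCircle →
        Integrable (fun x => (ENNReal.ofReal (w x)).toReal • g x) haarAddCircle := fun w hw => by
      have h1 : Integrable (fun x => max (w x) 0) haarAddCircle := hw.pos_part
      have h2 := h1.mul_bdd (c := ‖g‖) g.continuous.aestronglyMeasurable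
        (ae_of_all _ g.norm_coe_le_norm)
      refine h2.congr (ae_of_all _ fun x => ?_)
      simp [ENNReal.toReal_ofReal']
    rw [integral_withDensity_eq_integral_toReal_smul₀ hm1 (ae_of_all _ fun x => by simp),
      integral_withDensity_eq_integral_toReal_smul₀ hm2 (ae_of_all _ fun x => by simp),
      ← sub_eq_zero, ← integral_sub (hint v hv) (hint (fun x => -v x) hv.neg), ← h g]
    refine integral_congr_ae (ae_of_all _ fun x => ?_)
    simp only [ENNReal.toReal_ofReal', smul_eq_mul]
    rcases le_total 0 (v x) with hx | hx
    · rw [max_eq_left hx, max_eq_right (by linarith)]; ring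
    · rw [max_eq_right hx, max_eq_left (by linarith)]; ring
  rw [withDensity_eq_iff hm1 hm2 hf1] at heq
  filter_upwards [heq] with x hx
  have hx' := congrArg ENNReal.toReal hx
  simp only [ENNReal.toReal_ofReal'] at hx'
  rcases le_total 0 (v x) with h0 | h0
  · rw [max_eq_left h0, max_eq_right (by linarith)] at hx'; exact hx'
  · rw [max_eq_right h0, max_eq_left (by linarith)] at hx'
    simp only [Pi.zero_apply]; linarith

/-- An integrable function all of whose Fourier coefficients vanish is zero almost everywhere. -/
theorem ae_eq_zero_of_fourierCoeff_eq_zero {u : Circle2Pi → ℂ} (hu : Integrable u haarAddCircle)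
    (h : ∀ k, fourierCoeff u k = 0) : u =ᵐ[haarAddCircle] 0 := by
  have h1 : ∀ g : C(Circle2Pi, ℂ), pairing hu g = 0 := by
    -- The pairing is continuous and kills every exponential, hence the closure of their span, which
    -- is all of the continuous functions.
    have hle : (Submodule.span ℂ (Set.range (fourier (T := 2 * Real.pi)))).topologicalClosure ≤
        (pairing hu).ker := by
      refine Submodule.topologicalClosure_minimal _ ?_ (ContinuousLinearMap.isClosed_ker _)
      rw [Submodule.span_le]
      rintro _ ⟨k, rfl⟩
      have := h (-k)
      rw [fourierCoeff, neg_neg] at this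
      exact this
    rw [span_fourier_closure_eq_top] at hle
    intro g
    exact hle (Submodule.mem_top (x := g))
  have h2 : ∀ g : BoundedContinuousFunction Circle2Pi ℝ,
      ∫ x, ((g x : ℝ) : ℂ) * u x ∂haarAddCircle = 0 := fun g =>
    h1 ⟨fun x => ((g x : ℝ) : ℂ), Complex.continuous_ofReal.comp g.continuous⟩
  have hi : ∀ g : BoundedContinuousFunction Circle2Pi ℝ,
      Integrable (fun x => ((g x : ℝ) : ℂ) * u x) haarAddCircle := fun g =>
    integrable_continuousMap_mul hu
      ⟨fun x => ((g x : ℝ) : ℂ), Complex.continuous_ofReal.comp g.continuous⟩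
  have hre := ae_eq_zero_of_forall_integral_mul_eq_zero hu.re fun g => by
    have := congrArg Complex.re (h2 g)
    rw [← Complex.reCLM_apply, ← ContinuousLinearMap.integral_comp_comm _ (hi g)] at this
    simpa using this
  have him := ae_eq_zero_of_forall_integral_mul_eq_zero hu.im fun g => by
    have := congrArg Complex.im (h2 g)
    rw [← Complex.imCLM_apply, ← ContinuousLinearMap.integral_comp_comm _ (hi g)] at this
    simpa using this
  filter_upwards [hre, him] with x h1 h2
  exact Complex.ext h1 h2

/-- An integrable function with summable Fourier coefficients is almost everywhere the sum of its
Fourier series. -/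
theorem ae_hasSum_fourier_of_summable {f : Circle2Pi → ℂ} (hf : Integrable f haarAddCircle)
    (hs : Summable (fourierCoeff f)) :
    ∀ᵐ x ∂(haarAddCircle : Measure Circle2Pi),
      HasSum (fun k => fourierCoeff f k * fourier k x) (f x) := by
  have hs' : Summable (fun k => fourierCoeff f k • (fourier k : C(Circle2Pi, ℂ))) := by
    refine .of_norm ?_
    simpa only [norm_smul, fourier_norm, mul_one] using hs.norm
  -- The series converges uniformly to a continuous F with the same coefficients as f; uniqueness
  -- then identifies the two almost everywhere.
  set F : C(Circle2Pi, ℂ) := ∑' k, fourierCoeff f k • fourier k with hF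
  have hFi : Integrable F haarAddCircle :=
    F.continuous.integrable_of_hasCompactSupport (HasCompactSupport.of_compactSpace _)
  have hcoef : ∀ k, fourierCoeff F k = fourierCoeff f k := by
    intro k
    have hΛ : ∀ g : C(Circle2Pi, ℂ), pairing (integrable_fourier (-k)) g = fourierCoeff g k := by
      intro g
      rw [pairing_apply, fourierCoeff]
      simp [mul_comm]
    have h1 := (pairing (integrable_fourier (-k))).hasSum hs'.hasSum
    rw [← hF, hΛ] at h1
    refine h1.unique ?_
    have h2 : ∀ j, (pairing (integrable_fourier (-k))) (fourierCoeff f j • fourier j) =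
        if j = k then fourierCoeff f k else 0 := by
      intro j
      rw [map_smul, hΛ, fourierCoeff_fourier]
      by_cases hjk : j = k
      · subst hjk; simp
      · simp [hjk, Ne.symm hjk]
    simp only [h2]
    exact hasSum_ite_eq k _
  have hzero := ae_eq_zero_of_fourierCoeff_eq_zero (u := fun x => f x - F x) (hf.sub hFi)
    fun k => by
      have h1 := hf.fourier_smul (-k)
      have h2 := hFi.fourier_smul (-k)
      have : fourierCoeff (fun x => f x - F x) k = fourierCoeff f k - fourierCoeff F k := by
        unfold fourierCoeff
        rw [← integral_sub h1 h2]
        simp only [smul_sub]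
      rw [this, hcoef, sub_self]
  filter_upwards [hzero] with x hx
  have h1 := (ContinuousMap.evalCLM ℂ x).hasSum hs'.hasSum
  have h2 : f x = F x := sub_eq_zero.1 hx
  rw [h2]
  exact h1

/-! ### Coefficient bounds, convolution and Hölder's inequality -/

theorem fcoeff_neg (f : Circle2Pi → ℝ) (k : ℤ) :
    fcoeff f (-k) = (starRingEnd ℂ) (fcoeff f k) := by
  unfold fcoeff fourierCoeff
  rw [← integral_conj]
  refine integral_congr_ae (ae_of_all _ fun x => ?_)
  simp only [smul_eq_mul, map_mul, Complex.conj_ofReal, neg_neg]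
  rw [fourier_neg, Complex.conj_conj]

/-- On a probability space the L_1 norm is at most the L_p norm. -/
theorem norm_fcoeff_le_one {p : ℝ≥0∞} (hp : 1 ≤ p) {φ : Circle2Pi → ℝ} (hφ : MemLp φ p)
    (h1 : eLpNorm φ p ≤ 1) (k : ℤ) : ‖fcoeff φ k‖ ≤ 1 := by
  have hm : AEStronglyMeasurable φ haarAddCircle :=
    hφ.aestronglyMeasurable.mono_measure haarAddCircle_le_volume
  have h2 : ‖fcoeff φ k‖ₑ ≤ 1 := calc
    ‖fcoeff φ k‖ₑ ≤ ∫⁻ x, ‖fourier (-k) x • (φ x : ℂ)‖ₑ ∂haarAddCircle :=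
      enorm_integral_le_lintegral_enorm _
    _ = eLpNorm φ 1 haarAddCircle := by
      rw [eLpNorm_one_eq_lintegral_enorm]
      refine lintegral_congr fun x => ?_
      rw [← ofReal_norm, ← ofReal_norm, norm_smul, norm_fourier_apply, one_mul, Complex.norm_real]
    _ ≤ eLpNorm φ p haarAddCircle := eLpNorm_le_eLpNorm_of_exponent_le hp hm
    _ ≤ eLpNorm φ p volume := eLpNorm_mono_measure _ haarAddCircle_le_volume
    _ ≤ 1 := h1
  rw [← ofReal_norm, ← ENNReal.ofReal_one] at h2
  exact (ENNReal.ofReal_le_ofReal_iff zero_le_one).1 h2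

theorem fourier_sub (k : ℤ) (x t : Circle2Pi) :
    (fourier k (x - t) : ℂ) = fourier k x * fourier (-k) t := by
  rw [fourier_apply, fourier_apply, fourier_apply, zsmul_sub, sub_eq_add_neg, toCircle_add,
    Circle.coe_mul, neg_zsmul]

theorem sum_fcoeff_eq_integral {φ : Circle2Pi → ℝ} (hφi : Integrable φ)
    (s : Finset ℤ) (c : ℤ → ℂ) (x : Circle2Pi) :
    ∑ k ∈ s, c k * fcoeff φ k * fourier k x =
      ∫ t, (φ t : ℂ) * ∑ k ∈ s, c k * fourier k (x - t) ∂haarAddCircle := by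
  have hφc : Integrable (fun t => (φ t : ℂ)) haarAddCircle := (integrable_haar hφi).ofReal
  simp only [Finset.mul_sum]
  rw [integral_finsetSum]
  · refine Finset.sum_congr rfl fun k _ => ?_
    have h1 : c k * fcoeff φ k * fourier k x = c k * fourier k x * fcoeff φ k := by ring
    rw [h1, fcoeff, fourierCoeff]
    refine (integral_const_mul _ _).symm.trans (integral_congr_ae (ae_of_all _ fun t => ?_))
    simp only [fourier_sub, smul_eq_mul]
    ring
  · intro k _
    have h2 : Continuous fun t => c k * (fourier k (x - t) : ℂ) :=
      continuous_const.mul ((fourier k).continuous.comp (continuous_const.sub continuous_id))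
    exact hφc.mul_bdd (c := ‖c k‖) h2.aestronglyMeasurable
      (ae_of_all _ fun t => by rw [norm_mul, norm_fourier_apply, mul_one])

theorem eLpNorm_comp_sub_left {D : Circle2Pi → ℂ} (hD : Continuous D) (x : Circle2Pi)
    (q : ℝ≥0∞) : eLpNorm (fun t => D (x - t)) q volume = eLpNorm D q volume :=
  eLpNorm_comp_measurePreserving (f := fun t => x - t) hD.aestronglyMeasurable
    (Measure.measurePreserving_sub_left volume x)

theorem enorm_integral_mul_le {p q : ℝ} (hpq : p.HolderConjugate q) {φ : Circle2Pi → ℝ}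
    (hφi : AEStronglyMeasurable φ) (h1 : eLpNorm φ (ENNReal.ofReal p) ≤ 1) {D : Circle2Pi → ℂ}
    (hD : Continuous D) :
    ‖∫ t, (φ t : ℂ) * D t ∂haarAddCircle‖ₑ ≤ eLpNorm D (ENNReal.ofReal q) := by
  have i1 : ‖∫ t, (φ t : ℂ) * D t ∂haarAddCircle‖ₑ ≤
      ∫⁻ t, ‖(φ t : ℂ) * D t‖ₑ ∂haarAddCircle := enorm_integral_le_lintegral_enorm _
  have i2 : ∫⁻ t, ‖(φ t : ℂ) * D t‖ₑ ∂haarAddCircle ≤ ∫⁻ t, ‖(φ t : ℂ) * D t‖ₑ :=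
    lintegral_mono' haarAddCircle_le_volume le_rfl
  have i3 : ∫⁻ t, ‖(φ t : ℂ) * D t‖ₑ = ∫⁻ t, ((fun t => ‖φ t‖ₑ) * (fun t => ‖D t‖ₑ)) t := by
    refine lintegral_congr fun t => ?_
    rw [enorm_mul, Pi.mul_apply, ← ofReal_norm (φ t : ℂ), Complex.norm_real, ofReal_norm]
  have i4 := ENNReal.lintegral_mul_le_Lp_mul_Lq volume hpq hφi.enorm
    (hD.aestronglyMeasurable (μ := volume)).enorm
  have i5 : eLpNorm φ (ENNReal.ofReal p) = (∫⁻ t, ‖φ t‖ₑ ^ p) ^ (1 / p) := by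
    rw [eLpNorm_eq_lintegral_rpow_enorm_toReal (by simpa using hpq.pos) ENNReal.ofReal_ne_top,
      ENNReal.toReal_ofReal hpq.nonneg]
  have i6 : eLpNorm D (ENNReal.ofReal q) = (∫⁻ t, ‖D t‖ₑ ^ q) ^ (1 / q) := by
    rw [eLpNorm_eq_lintegral_rpow_enorm_toReal (by simpa using hpq.symm.pos) ENNReal.ofReal_ne_top,
      ENNReal.toReal_ofReal hpq.symm.nonneg]
  rw [← i5, ← i6] at i4
  refine (i1.trans i2).trans ((i3.trans_le i4).trans ?_)
  exact mul_le_of_le_one_left' h1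

/-- A partial sum of a convolution is bounded by Hölder's inequality. -/
theorem enorm_sum_fcoeff_le {p q : ℝ} (hpq : p.HolderConjugate q) {φ : Circle2Pi → ℝ}
    (hφi : Integrable φ) (h1 : eLpNorm φ (ENNReal.ofReal p) ≤ 1)
    (s : Finset ℤ) (c : ℤ → ℂ) (x : Circle2Pi) :
    ‖∑ k ∈ s, c k * fcoeff φ k * fourier k x‖ₑ ≤
      eLpNorm (fun t : Circle2Pi => ∑ k ∈ s, c k * fourier k t) (ENNReal.ofReal q) := by
  have hDc : Continuous fun t : Circle2Pi => ∑ k ∈ s, c k * (fourier k t : ℂ) :=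
    continuous_finsetSum _ fun k _ => continuous_const.mul (fourier k).continuous
  rw [sum_fcoeff_eq_integral hφi]
  refine (enorm_integral_mul_le hpq hφi.aestronglyMeasurable h1
    (hDc.comp (continuous_const.sub continuous_id))).trans_eq ?_
  exact eLpNorm_comp_sub_left hDc x _

/-! ### Upper bound: Fourier sums -/

variable {β : ℝ} {f φ : Circle2Pi → ℝ}

/-- On positive frequencies β enters only through a common phase, which disappears from all norms.
-/
theorem IsPsiBetaDeriv.fcoeff_natCast (h : IsPsiBetaDeriv ψ β f φ) {k : ℕ} (hk : 1 ≤ k)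
    (hψ : 0 < ψ k) :
    fcoeff f k = Complex.exp (-(Complex.I * ((β * Real.pi / 2 : ℝ) : ℂ))) *
      ((ψ k : ℂ) * fcoeff φ k) := by
  have h1 := h.2.2 k (by exact_mod_cast (by omega : k ≠ 0))
  have h2 : ((k : ℤ).sign : ℝ) = 1 := by
    rw [Int.sign_eq_one_of_pos (by omega)]; simp
  have h3 : |((k : ℤ) : ℝ)| = k := by simp
  rw [h2, h3, mul_one] at h1
  have h4 : (ψ k : ℂ) ≠ 0 := by exact_mod_cast hψ.ne'
  rw [h1, Complex.exp_neg]
  have := Complex.exp_ne_zero (Complex.I * ((β * Real.pi / 2 : ℝ) : ℂ))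
  field_simp

theorem norm_fcoeff_natCast_le (hψ : MemM ψ) {p : ℝ≥0∞} (hp : 1 ≤ p)
    (h : IsPsiBetaDeriv ψ β f φ) (hφ : φ ∈ unitBallZero p) {k : ℕ} (hk : 1 ≤ k) :
    ‖fcoeff f k‖ ≤ ψ k := by
  have hpos := hψ.pos k (by exact_mod_cast hk)
  rw [h.fcoeff_natCast hk hpos, norm_mul, norm_mul, Complex.norm_real, Real.norm_eq_abs,
    abs_of_pos hpos]
  have h1 : ‖Complex.exp (-(Complex.I * ((β * Real.pi / 2 : ℝ) : ℂ)))‖ = 1 := by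
    rw [mul_comm, ← neg_mul, ← Complex.ofReal_neg, Complex.norm_exp_ofReal_mul_I]
  rw [h1, one_mul]
  exact mul_le_of_le_one_right hpos.le (norm_fcoeff_le_one hp hφ.1 hφ.2.1 k)

/-- The blocks of the Fourier series of a function of the class beyond the `n`-th harmonic. -/
theorem exists_norm_block_le {p : ℝ} (hp : 1 < p) (hψ : MemMTwo ψ) :
    ∃ C : ℝ, 0 < C ∧ ∀ n : ℕ, 1 ≤ n → ∀ (β : ℝ) (f φ : Circle2Pi → ℝ),
      IsPsiBetaDeriv ψ β f φ → φ ∈ unitBallZero (ENNReal.ofReal p) → ∀ (M : ℕ) (x : Circle2Pi),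
        ‖∑ k ∈ Finset.Ico n M, fcoeff f k * fourier (k : ℤ) x‖ ≤
          C * (ψ n * (eta ψ n - n) ^ (1 / p)) := by
  obtain ⟨C₀, hC₀, hsum⟩ := exists_sum_Ico_le hψ
  obtain ⟨K, hK0, hK⟩ := hψ.eta_sub_ge
  have hM := hψ.toMemM
  have hpq := Real.HolderConjugate.conjExponent hp
  set q := p.conjExponent with hq
  have hτ : tailConst q ^ (1 / q) ≠ ⊤ :=
    ENNReal.rpow_ne_top_of_nonneg (by have := hpq.symm.pos; positivity)
      (tailConst_lt_top hpq.symm.lt).ne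
  set τ := (tailConst q ^ (1 / q)).toReal with hτ'
  refine ⟨2 * (C₀ + Real.pi) * (τ + 1), by positivity, ?_⟩
  intro n hn β f φ h hφ M x
  have hn1 : (1 : ℝ) ≤ n := by exact_mod_cast hn
  have hpos := hM.pos n hn1
  have ha0 : 0 < eta ψ n - n := hK0.trans_le (hK n hn1)
  set a := eta ψ n - n with ha
  set s : Finset ℤ := (Finset.Ico n M).map Nat.castEmbedding with hs
  set c : ℤ → ℂ := fun k => (ψ k : ℂ) with hc
  have hD : ∀ t : Circle2Pi, ∑ k ∈ s, c k * fourier k t =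
      ∑ k ∈ Finset.Ico n M, (ψ k : ℂ) * fourier (k : ℤ) t := fun t => by
    rw [hs, Finset.sum_map]; simp [hc]
  have e1 : ∑ k ∈ Finset.Ico n M, fcoeff f k * fourier (k : ℤ) x =
      Complex.exp (-(Complex.I * ((β * Real.pi / 2 : ℝ) : ℂ))) *
        ∑ k ∈ s, c k * fcoeff φ k * fourier k x := by
    rw [hs, Finset.sum_map, Finset.mul_sum]
    refine Finset.sum_congr rfl fun k hk => ?_
    have hk1 : 1 ≤ k := hn.trans (Finset.mem_Ico.1 hk).1
    rw [h.fcoeff_natCast hk1 (hM.pos k (by exact_mod_cast hk1))]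
    simp only [hc, Nat.castEmbedding_apply, Int.cast_natCast]
    ring
  have h1 : ‖Complex.exp (-(Complex.I * ((β * Real.pi / 2 : ℝ) : ℂ)))‖ = 1 := by
    rw [mul_comm, ← neg_mul, ← Complex.ofReal_neg, Complex.norm_exp_ofReal_mul_I]
  rw [e1, norm_mul, h1, one_mul]
  have h2 := enorm_sum_fcoeff_le hpq h.1 hφ.2.1 s c x
  -- The summand C₀ covers the bound by the sum of the coefficients, π the bound by Abel summation.
  have hB : (0 : ℝ) ≤ (C₀ + Real.pi) * ψ n := by positivity
  have h3 := eLpNorm_le_of_peak hpq.symm.lt ha0 hB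
    (fun t => ∑ k ∈ s, c k * fourier k t) (fun t _ => by
      rw [hD]
      calc ‖∑ k ∈ Finset.Ico n M, (ψ k : ℂ) * fourier (k : ℤ) (t : Circle2Pi)‖
          ≤ ∑ k ∈ Finset.Ico n M, ψ k := by
            refine norm_sum_le_of_le _ fun k hk => ?_
            have hk1 : 1 ≤ k := hn.trans (Finset.mem_Ico.1 hk).1
            rw [norm_mul, norm_fourier_apply, mul_one, Complex.norm_real, Real.norm_eq_abs,
              abs_of_pos (hM.pos k (by exact_mod_cast hk1))]
        _ ≤ C₀ * (ψ n * a) := hsum n hn M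
        _ ≤ (C₀ + Real.pi) * ψ n * a := by
            have : 0 ≤ Real.pi * (ψ n * a) := by positivity
            linarith)
    (fun t ht => by
      rw [hD]
      refine (abs_mul_norm_sum_antitone_le ht (fun k => ψ k) n M (fun k hk => ?_)
        (fun k hk => ?_)).trans ?_
      · exact (hM.pos k (by exact_mod_cast hn.trans hk)).le
      · have hk1 : (1 : ℝ) ≤ k := by exact_mod_cast hn.trans hk
        exact hM.antitoneOn hk1 (show (1 : ℝ) ≤ ((k + 1 : ℕ) : ℝ) by push_cast; linarith)
          (by push_cast; linarith)
      · have : 0 ≤ C₀ * ψ n := by positivity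
        linarith)
  have he : 1 - 1 / q = 1 / p := by
    have := hpq.inv_add_inv_eq_one
    rw [one_div, one_div]; linarith
  rw [he] at h3
  have h4 := h2.trans h3
  rw [← ENNReal.ofReal_toReal hτ, ← hτ', ← ENNReal.ofReal_mul (by positivity), ← ofReal_norm,
    ENNReal.ofReal_le_ofReal_iff (by positivity)] at h4
  refine h4.trans ?_
  have : 0 ≤ 2 * ((C₀ + Real.pi) * ψ n) * a ^ (1 / p) := by positivity
  linarith

/-- The tail estimate at n = 1 bounds all partial sums of ψ, which dominate the coefficients. -/
theorem summable_fcoeff {p : ℝ≥0∞} (hp : 1 ≤ p) (hψ : MemMTwo ψ)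
    (h : IsPsiBetaDeriv ψ β f φ) (hφ : φ ∈ unitBallZero p) :
    Summable (fcoeff f) := by
  obtain ⟨C₀, hC₀, hsum⟩ := exists_sum_Ico_le hψ
  have hM := hψ.toMemM
  have hs : Summable fun k : ℕ => ψ (k + 1 : ℕ) := by
    refine summable_of_sum_range_le (c := C₀ * (ψ (1 : ℕ) * (eta ψ (1 : ℕ) - (1 : ℕ))))
      (fun k => (hM.pos _ (by push_cast; linarith [(Nat.cast_nonneg k : (0 : ℝ) ≤ k)])).le)
      fun N => ?_
    have := hsum 1 le_rfl (N + 1)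
    rw [Finset.sum_Ico_eq_sum_range, Nat.add_sub_cancel] at this
    simpa only [add_comm 1] using this
  have h1 : Summable fun k : ℕ => fcoeff f k := by
    rw [← summable_nat_add_iff 1]
    exact .of_norm_bounded hs fun k => norm_fcoeff_natCast_le hM hp h hφ (by omega)
  refine .of_nat_of_neg h1 ?_
  simp only [fcoeff_neg]
  exact .of_norm (by simpa only [RCLike.norm_conj] using h1.norm)

theorem partialSum_insert {γ : Finset ℤ} {n : ℤ} (hn : n ∉ γ) (x : Circle2Pi) :
    partialSum (insert n γ) f x = fcoeff f n * fourier n x + partialSum γ f x :=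
  Finset.sum_insert hn

theorem partialSum_Ioo_succ (n : ℕ) (hn : 1 ≤ n) (x : Circle2Pi) :
    partialSum (Finset.Ioo (-((n + 1 : ℕ) : ℤ)) ((n + 1 : ℕ) : ℤ)) f x =
      partialSum (Finset.Ioo (-(n : ℤ)) n) f x +
        (fcoeff f n * fourier n x + (starRingEnd ℂ) (fcoeff f n * fourier n x)) := by
  have e : Finset.Ioo (-((n + 1 : ℕ) : ℤ)) ((n + 1 : ℕ) : ℤ) =
      insert (n : ℤ) (insert (-(n : ℤ)) (Finset.Ioo (-(n : ℤ)) n)) := by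
    ext k; simp only [Finset.mem_insert, Finset.mem_Ioo]; omega
  rw [e, partialSum_insert (by simp only [Finset.mem_insert, Finset.mem_Ioo]; omega),
    partialSum_insert (by simp), map_mul, ← fcoeff_neg, ← fourier_neg]
  ring

/-- As f is real, the negative frequencies contribute the conjugate of the positive ones, so
estimating a one-sided block suffices, at the cost of a factor 2. -/
theorem partialSum_Ioo_sub (n : ℕ) (hn : 1 ≤ n) (M : ℕ) (hM : n ≤ M) (x : Circle2Pi) :
    partialSum (Finset.Ioo (-(M : ℤ)) M) f x = partialSum (Finset.Ioo (-(n : ℤ)) n) f x +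
      (∑ k ∈ Finset.Ico n M, fcoeff f k * fourier (k : ℤ) x +
        (starRingEnd ℂ) (∑ k ∈ Finset.Ico n M, fcoeff f k * fourier (k : ℤ) x)) := by
  induction M, hM using Nat.le_induction with
  | base => simp
  | succ M hM ih =>
    rw [partialSum_Ioo_succ M (hn.trans hM), ih, Finset.sum_Ico_succ_top hM, map_add]
    ring

/-- Fourier sums of order `n - 1` approximate the class in the uniform norm. -/
theorem exists_ae_norm_sub_partialSum_le {p : ℝ} (hp : 1 < p) (hψ : MemMTwo ψ) (β : ℝ) :
    ∃ C : ℝ, 0 < C ∧ ∀ n : ℕ, 1 ≤ n → ∀ f ∈ psiBetaClass ψ β (ENNReal.ofReal p),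
      ‖fcoeff f n‖ ≤ ψ n ∧ ∀ᵐ x, ‖(f x : ℂ) - partialSum (Finset.Ioo (-(n : ℤ)) n) f x‖ ≤
        C * (ψ n * (eta ψ n - n) ^ (1 / p)) := by
  obtain ⟨C, hC, hblock⟩ := exists_norm_block_le hp hψ
  have hp1 : 1 ≤ ENNReal.ofReal p := ENNReal.one_le_ofReal.2 hp.le
  refine ⟨2 * C, by positivity, fun n hn f hf => ?_⟩
  obtain ⟨hfi, φ, hφ, hφB⟩ := hf
  refine ⟨norm_fcoeff_natCast_le hψ.toMemM hp1 hφ hφB hn, ?_⟩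
  have hae := ae_hasSum_fourier_of_summable (integrable_haar hfi).ofReal
    (summable_fcoeff hp1 hψ hφ hφB)
  filter_upwards [volume_absolutelyContinuous_haarAddCircle.ae_le hae] with x hx
  have ht : Tendsto (fun M : ℕ => Finset.Ioo (-(M : ℤ)) M) atTop atTop := by
    refine tendsto_atTop_finset_of_monotone (fun a b hab => ?_) fun k => ⟨k.natAbs + 1, ?_⟩
    · exact Finset.Ioo_subset_Ioo (by simpa using hab) (by simpa using hab)
    · rw [Finset.mem_Ioo]; omega
  have hlim := hx.comp ht
  have hlim2 := (hlim.sub_const (partialSum (Finset.Ioo (-(n : ℤ)) n) f x)).norm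
  refine le_of_tendsto hlim2 ?_
  filter_upwards [eventually_ge_atTop n] with M hM
  have h1 := hblock n hn β f φ hφ hφB M x
  change ‖partialSum (Finset.Ioo (-(M : ℤ)) M) f x - _‖ ≤ _
  rw [partialSum_Ioo_sub n hn M hM, add_sub_cancel_left]
  refine (norm_add_le _ _).trans ?_
  rw [RCLike.norm_conj]
  linarith

/-- The frequencies |k| < n number 2n - 1. For 2n of them, n is added; its term is at most ψ(n),
which the bound absorbs because η(n) - n ≥ K. -/
theorem exists_bestOrthClass_le {p : ℝ} (hp : 1 < p) (hψ : MemMTwo ψ) (β : ℝ) :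
    ∃ C : ℝ, 0 < C ∧ ∀ n : ℕ, 1 ≤ n → ∀ m : ℕ, m = 2 * n - 1 ∨ m = 2 * n →
      bestOrthClass m ⊤ (psiBetaClass ψ β (ENNReal.ofReal p)) ≤
        ENNReal.ofReal (C * (ψ n * (eta ψ n - n) ^ (1 / p))) := by
  obtain ⟨C, hC, hC'⟩ := exists_ae_norm_sub_partialSum_le hp hψ β
  obtain ⟨K, hK0, hK⟩ := hψ.eta_sub_ge
  have hL : 0 < K ^ (1 / p) := Real.rpow_pos_of_pos hK0 _
  refine ⟨C + 1 / K ^ (1 / p), by positivity, fun n hn m hm => iSup₂_le fun f hf => ?_⟩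
  obtain ⟨h1, h2⟩ := hC' n hn f hf
  have hn1 : (1 : ℝ) ≤ n := by exact_mod_cast hn
  have hpos := hψ.pos n hn1
  have ha := hK n hn1
  have h3 : ψ n ≤ 1 / K ^ (1 / p) * (ψ n * (eta ψ n - n) ^ (1 / p)) := by
    rw [one_div, ← div_eq_inv_mul, le_div_iff₀ (by simpa using hL)]
    gcongr
  obtain ⟨γ, hcard, hγ⟩ : ∃ γ : Finset ℤ, γ.card = m ∧ ∀ᵐ x, ‖(f x : ℂ) - partialSum γ f x‖ ≤
      (C + 1 / K ^ (1 / p)) * (ψ n * (eta ψ n - n) ^ (1 / p)) := by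
    rcases hm with rfl | rfl
    · refine ⟨Finset.Ioo (-(n : ℤ)) n, by rw [Int.card_Ioo]; omega, ?_⟩
      filter_upwards [h2] with x hx
      linarith
    · refine ⟨insert (n : ℤ) (Finset.Ioo (-(n : ℤ)) n), ?_, ?_⟩
      · rw [Finset.card_insert_of_notMem (by simp), Int.card_Ioo]; omega
      filter_upwards [h2] with x hx
      rw [partialSum_insert (by simp), add_comm, ← sub_sub]
      refine (norm_sub_le _ _).trans ?_
      rw [norm_mul, norm_fourier_apply, mul_one]
      linarith
  refine (iInf_le _ ⟨γ, hcard⟩).trans ?_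
  rw [eLpNorm_exponent_top]
  refine eLpNormEssSup_le_of_ae_enorm_bound (hγ.mono fun x hx => ?_)
  rw [← ofReal_norm]
  exact ENNReal.ofReal_le_ofReal hx

/-! ### Fejér kernel and trigonometric polynomials -/

theorem sum_fourierCoeff_sub_eq_integral {h : Circle2Pi → ℂ} (hi : Integrable h haarAddCircle)
    (M : ℕ) :
    ∑ j ∈ Finset.range M, ∑ l ∈ Finset.range M, fourierCoeff h ((l : ℤ) - j) =
      ∫ x, ((‖∑ j ∈ Finset.range M, (fourier (j : ℤ) x : ℂ)‖ ^ 2 : ℝ) : ℂ) * h x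
        ∂haarAddCircle := by
  have e : ∀ x : Circle2Pi, ((‖∑ j ∈ Finset.range M, (fourier (j : ℤ) x : ℂ)‖ ^ 2 : ℝ) : ℂ) * h x =
      ∑ j ∈ Finset.range M, ∑ l ∈ Finset.range M, fourier (-((l : ℤ) - j)) x • h x := by
    intro x
    push_cast
    rw [← Complex.mul_conj', map_sum, Finset.sum_mul_sum, Finset.sum_mul]
    refine Finset.sum_congr rfl fun j _ => ?_
    rw [Finset.sum_mul]
    refine Finset.sum_congr rfl fun l _ => ?_
    rw [← fourier_neg, smul_eq_mul, ← fourier_add]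
    congr 2
    ring_nf
  simp only [e]
  rw [integral_finsetSum _ fun j _ => integrable_finsetSum _ fun l _ => hi.fourier_smul _]
  refine Finset.sum_congr rfl fun j _ => ?_
  rw [integral_finsetSum _ fun l _ => hi.fourier_smul _]
  rfl

/-- The Fejér kernel bounds means of Fourier coefficients by the uniform norm. -/
theorem norm_sum_fourierCoeff_sub_le {h : Circle2Pi → ℂ} (hi : Integrable h haarAddCircle)
    {s : ℝ} (hs : ∀ᵐ x ∂(haarAddCircle : Measure Circle2Pi), ‖h x‖ ≤ s) (M : ℕ) :
    ‖∑ j ∈ Finset.range M, ∑ l ∈ Finset.range M, fourierCoeff h ((l : ℤ) - j)‖ ≤ s * M := by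
  have hc : Continuous fun x : Circle2Pi =>
      ‖∑ j ∈ Finset.range M, (fourier (j : ℤ) x : ℂ)‖ ^ 2 :=
    (continuous_finsetSum _ fun j _ =>
      (fourier ((j : ℕ) : ℤ) : C(Circle2Pi, ℂ)).continuous).norm.fun_pow 2
  -- The total mass comes from the same identity with h = 1, where only the diagonal pairs j = l
  -- count.
  have hint : ∫ x : Circle2Pi, ‖∑ j ∈ Finset.range M, (fourier (j : ℤ) x : ℂ)‖ ^ 2
      ∂haarAddCircle = M := by
    have h1 := sum_fourierCoeff_sub_eq_integral (integrable_fourier 0) M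
    rw [fourierCoeff_fourier] at h1
    simp only [fourier_zero, mul_one] at h1
    rw [integral_complex_ofReal] at h1
    have h2 : ∑ j ∈ Finset.range M, ∑ l ∈ Finset.range M,
        (Pi.single (0 : ℤ) (1 : ℂ) : ℤ → ℂ) ((l : ℤ) - j) = M := by
      have : ∀ j ∈ Finset.range M, ∑ l ∈ Finset.range M,
          (Pi.single (0 : ℤ) (1 : ℂ) : ℤ → ℂ) ((l : ℤ) - j) = 1 := by
        intro j hj
        rw [Finset.sum_eq_single_of_mem j hj]
        · simp
        · intro l _ hl
          rw [Pi.single_eq_of_ne]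
          omega
      rw [Finset.sum_congr rfl this]; simp
    rw [h2] at h1
    exact_mod_cast h1.symm
  rw [sum_fourierCoeff_sub_eq_integral hi, mul_comm s, ← hint]
  refine (norm_integral_le_of_norm_le (g := fun x : Circle2Pi =>
    ‖∑ j ∈ Finset.range M, (fourier (j : ℤ) x : ℂ)‖ ^ 2 * s) ?_ ?_).trans_eq
      (integral_mul_const _ _)
  · exact (hc.integrable_of_hasCompactSupport (HasCompactSupport.of_compactSpace _)).mul_const _
  · filter_upwards [hs] with x hx
    rw [norm_mul, Complex.norm_real, Real.norm_eq_abs, abs_of_nonneg (by positivity)]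
    gcongr

/-- Each k with |k| ≤ N is a difference of at least 2N - |k| ≥ N pairs in the square of side 2N; the
injection exhibits N of them. -/
theorem card_mul_le_card_filter_sub_mem (U : Finset ℤ) (N : ℕ)
    (hU : U ⊆ Finset.Icc (-(N : ℤ)) N) :
    U.card * N ≤ ((Finset.range (2 * N) ×ˢ Finset.range (2 * N)).filter
      fun x : ℕ × ℕ => (x.2 : ℤ) - x.1 ∈ U).card := by
  have : U.card * N = (U ×ˢ Finset.range N).card := by simp
  rw [this]
  refine Finset.card_le_card_of_injOn
    (fun y : ℤ × ℕ => (y.2 + (-y.1).toNat, y.2 + y.1.toNat)) ?_ ?_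
  · rintro ⟨k, i⟩ hy
    simp only [Finset.coe_product, Set.mem_prod, Finset.mem_coe, Finset.mem_range] at hy
    have hk := Finset.mem_Icc.1 (hU hy.1)
    simp only [Finset.coe_filter, Finset.mem_product, Finset.mem_range, Set.mem_ofPred_eq]
    refine ⟨⟨by omega, by omega⟩, ?_⟩
    have : ((i + k.toNat : ℕ) : ℤ) - ((i + (-k).toNat : ℕ) : ℤ) = k := by omega
    rw [this]
    exact hy.1
  · rintro ⟨k, i⟩ _ ⟨k', i'⟩ _ h
    simp only [Prod.mk.injEq] at h ⊢
    omega

theorem fourierCoeff_trigPoly (γ : Finset ℤ) (b : ℤ → ℂ) (m : ℤ) :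
    fourierCoeff (fun x : Circle2Pi => ∑ k ∈ γ, b k * fourier k x) m =
      if m ∈ γ then b m else 0 := by
  have e : (fun x : Circle2Pi => ∑ k ∈ γ, b k * (fourier k x : ℂ)) =
      ∑ k ∈ γ, fun x : Circle2Pi => b k * (fourier k x : ℂ) := by
    ext x; simp
  rw [e, fourierCoeff.sum _ _ fun k _ => (integrable_fourier k).const_mul _, Finset.sum_apply]
  have : ∀ k, fourierCoeff (fun x : Circle2Pi => b k * (fourier k x : ℂ)) m =
      if m = k then b k else 0 := by
    intro k
    have h1 := fourierCoeff.const_mul (T := 2 * Real.pi) (fourier k) (b k) m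
    rw [fourierCoeff_fourier] at h1
    rw [h1, Pi.single_apply]
    simp
  simp only [this, Finset.sum_ite_eq]

theorem continuous_trigPoly (γ : Finset ℤ) (b : ℤ → ℂ) :
    Continuous fun x : Circle2Pi => ∑ k ∈ γ, b k * (fourier k x : ℂ) :=
  continuous_finsetSum _ fun k _ => continuous_const.mul (fourier k).continuous

/-- The real trigonometric polynomial with Fourier coefficients `b k` at `1 ≤ k ≤ N`. -/
noncomputable def realTrigPoly (N : ℕ) (b : ℤ → ℂ) (x : Circle2Pi) : ℝ :=
  2 * (∑ k ∈ Finset.Icc (1 : ℤ) N, b k * fourier k x).re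

theorem continuous_realTrigPoly (N : ℕ) (b : ℤ → ℂ) : Continuous (realTrigPoly N b) :=
  continuous_const.mul (Complex.continuous_re.comp (continuous_trigPoly _ b))

theorem integrable_realTrigPoly (N : ℕ) (b : ℤ → ℂ) : Integrable (realTrigPoly N b) :=
  (continuous_realTrigPoly N b).integrable_of_hasCompactSupport
    (HasCompactSupport.of_compactSpace _)

theorem fcoeff_realTrigPoly (N : ℕ) (b : ℤ → ℂ) {m : ℤ} (hm : 0 ≤ m) :
    fcoeff (realTrigPoly N b) m = if m ∈ Finset.Icc (1 : ℤ) N then b m else 0 := by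
  set T : Circle2Pi → ℂ := fun x => ∑ k ∈ Finset.Icc (1 : ℤ) N, b k * fourier k x with hT
  set T' : Circle2Pi → ℂ := fun x => ∑ k ∈ Finset.Icc (-(N : ℤ)) (-1),
    (starRingEnd ℂ) (b (-k)) * fourier k x with hT'
  have e : (fun x => (realTrigPoly N b x : ℂ)) = T + T' := by
    ext x
    have h1 : T' x = (starRingEnd ℂ) (T x) := by
      simp only [hT, hT', map_sum, map_mul]
      refine Finset.sum_nbij' (fun k => -k) (fun k => -k) ?_ ?_ ?_ ?_ ?_
      · intro k hk; rw [Finset.mem_Icc] at hk ⊢; omega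
      · intro k hk; rw [Finset.mem_Icc] at hk ⊢; omega
      · intro k _; simp
      · intro k _; simp
      · intro k _; rw [fourier_neg, Complex.conj_conj]
    rw [Pi.add_apply, h1, Complex.add_conj]
    rfl
  have hi : Integrable T haarAddCircle :=
    (continuous_trigPoly _ b).integrable_of_hasCompactSupport (HasCompactSupport.of_compactSpace _)
  have hi' : Integrable T' haarAddCircle :=
    (continuous_trigPoly _ _).integrable_of_hasCompactSupport (HasCompactSupport.of_compactSpace _)
  rw [fcoeff, e, fourierCoeff.add hi hi', Pi.add_apply, hT, hT', fourierCoeff_trigPoly,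
    fourierCoeff_trigPoly, if_neg (c := m ∈ Finset.Icc (-(N : ℤ)) (-1)), add_zero]
  rw [Finset.mem_Icc]; omega

/-! ### Lower bound: a Dirichlet kernel as test function -/

/-- The uniform norm of what is left of a scaled Dirichlet kernel after removing `|γ|` harmonics. -/
theorem le_eLpNorm_dirichlet_sub_partialSum {w : ℝ} (hw : 0 ≤ w) {n N : ℕ} (hnN : n ≤ N)
    (hN : 1 ≤ N) (γ : Finset ℤ) (hγ : γ.card ≤ 2 * n) :
    ENNReal.ofReal (w * (N - n)) ≤ eLpNorm (fun x =>
      (realTrigPoly N (fun _ => (w : ℂ)) x : ℂ) -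
        partialSum γ (realTrigPoly N (fun _ => (w : ℂ))) x) ⊤ volume := by
  set f := realTrigPoly N (fun _ => (w : ℂ)) with hf
  set h : Circle2Pi → ℂ := fun x => (f x : ℂ) - partialSum γ f x with hh
  rcases eq_or_ne (eLpNorm h ⊤ volume) ⊤ with htop | htop
  · rw [htop]; exact le_top
  set s := (eLpNorm h ⊤ volume).toReal with hs
  have hae : ∀ᵐ x ∂(haarAddCircle : Measure Circle2Pi), ‖h x‖ ≤ s := by
    have h1 : ∀ᵐ x, ‖h x‖ₑ ≤ eLpNorm h ⊤ volume := by
      rw [eLpNorm_exponent_top]; exact ae_le_eLpNormEssSup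
    have h2 := (Measure.absolutelyContinuous_of_le haarAddCircle_le_volume).ae_le h1
    filter_upwards [h2] with x hx
    rw [hs, ← toReal_enorm]
    exact ENNReal.toReal_mono htop hx
  have hfi : Integrable (fun x => (f x : ℂ)) haarAddCircle :=
    (integrable_haar (integrable_realTrigPoly N _)).ofReal
  have hSi : Integrable (partialSum γ f) haarAddCircle :=
    (continuous_trigPoly γ (fcoeff f)).integrable_of_hasCompactSupport
      (HasCompactSupport.of_compactSpace _)
  set U : Finset ℤ := ((Finset.Icc (-(N : ℤ)) N).erase 0) \ γ with hU
  have hfc : ∀ k, fcoeff f k = if k ∈ (Finset.Icc (-(N : ℤ)) N).erase 0 then (w : ℂ) else 0 := by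
    intro k
    rcases le_total 0 k with hk | hk
    · rw [hf, fcoeff_realTrigPoly _ _ hk]
      refine if_congr ?_ rfl rfl
      simp only [Finset.mem_Icc, Finset.mem_erase]; omega
    · have h1 : fcoeff f k = (starRingEnd ℂ) (fcoeff f (-k)) := by rw [← fcoeff_neg, neg_neg]
      rw [h1, hf, fcoeff_realTrigPoly _ _ (by omega), apply_ite (starRingEnd ℂ), map_zero,
        Complex.conj_ofReal]
      refine if_congr ?_ rfl rfl
      simp only [Finset.mem_Icc, Finset.mem_erase]; omega
  have hcoef : ∀ k, fourierCoeff h k = if k ∈ U then (w : ℂ) else 0 := by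
    intro k
    have h1 : fourierCoeff h k = fcoeff f k - fourierCoeff (partialSum γ f) k := by
      unfold fcoeff fourierCoeff
      rw [← integral_sub (hfi.fourier_smul (-k)) (hSi.fourier_smul (-k))]
      simp only [hh, smul_sub]
    have h2 : fourierCoeff (partialSum γ f) k = if k ∈ γ then fcoeff f k else 0 :=
      fourierCoeff_trigPoly γ (fcoeff f) k
    rw [h1, h2, hfc, hU]
    by_cases hk : k ∈ γ <;> by_cases hk' : k ∈ (Finset.Icc (-(N : ℤ)) N).erase 0 <;>
      simp only [hk, hk', Finset.mem_sdiff, if_true, if_false, sub_self, sub_zero, not_true,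
        not_false_iff, and_true, and_false]
  -- A kernel of twice the degree gives every surviving frequency a weight of at least N, half of
  -- the maximal weight 2N.
  have hmain := norm_sum_fourierCoeff_sub_le (hfi.sub hSi) hae (2 * N)
  have hcoef' : ∀ k, fourierCoeff ((fun x => (f x : ℂ)) - partialSum γ f) k =
    if k ∈ U then (w : ℂ) else 0 := hcoef
  simp only [hcoef'] at hmain
  rw [← Finset.sum_product' (f := fun j l : ℕ => if (l : ℤ) - j ∈ U then (w : ℂ) else 0),
    ← Finset.sum_filter, Finset.sum_const, nsmul_eq_mul, norm_mul, Complex.norm_natCast,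
    Complex.norm_real, Real.norm_eq_abs, abs_of_nonneg hw] at hmain
  have hcard := card_mul_le_card_filter_sub_mem U N
    (Finset.sdiff_subset.trans (Finset.erase_subset _ _))
  have hUcard : 2 * N - 2 * n ≤ U.card := by
    have h1 := Finset.le_card_sdiff γ ((Finset.Icc (-(N : ℤ)) N).erase 0)
    rw [Finset.card_erase_of_mem (by simp), Int.card_Icc] at h1
    rw [hU]; omega
  have h3 : (2 * N - 2 * n) * N ≤ _ := (Nat.mul_le_mul_right N hUcard).trans hcard
  have h4 : (((2 * N - 2 * n) * N : ℕ) : ℝ) * w ≤ s * ((2 * N : ℕ) : ℝ) :=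
    (mul_le_mul_of_nonneg_right (by exact_mod_cast h3) hw).trans hmain
  rw [Nat.cast_mul, Nat.cast_sub (by omega)] at h4
  push_cast at h4
  have hN0 : (0 : ℝ) < N := by exact_mod_cast hN
  have h5 : w * (N - n) ≤ s := by
    have : 2 * (N : ℝ) * (w * (N - n)) ≤ 2 * N * s := by linarith
    exact le_of_mul_le_mul_left this (by positivity)
  rw [← ENNReal.ofReal_toReal htop, ← hs]
  exact ENNReal.ofReal_le_ofReal h5

theorem isPsiBetaDeriv_realTrigPoly (ψ : ℝ → ℝ) (β : ℝ) (N : ℕ) (w : ℝ) :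
    IsPsiBetaDeriv ψ β (realTrigPoly N fun _ => (w : ℂ)) (realTrigPoly N fun k =>
      ((w / ψ k : ℝ) : ℂ) * Complex.exp (Complex.I * ((β * Real.pi / 2 : ℝ) : ℂ))) := by
  refine ⟨integrable_realTrigPoly N _, ?_, ?_⟩
  · rw [fcoeff_realTrigPoly _ _ le_rfl, if_neg (by simp)]
  have hpos : ∀ k : ℤ, 0 < k →
      fcoeff (realTrigPoly N fun k => ((w / ψ k : ℝ) : ℂ) *
        Complex.exp (Complex.I * ((β * Real.pi / 2 : ℝ) : ℂ))) k =
      fcoeff (realTrigPoly N fun _ => (w : ℂ)) k / (ψ k : ℂ) *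
        Complex.exp (Complex.I * ((β * Real.pi / 2 : ℝ) : ℂ)) := by
    intro k hk
    rw [fcoeff_realTrigPoly _ _ hk.le, fcoeff_realTrigPoly _ _ hk.le]
    split_ifs
    · push_cast; ring
    · simp
  intro k hk
  rcases lt_or_gt_of_ne hk with hk | hk
  · have h1 := hpos (-k) (by omega)
    have h2 := congrArg (starRingEnd ℂ) h1
    rw [← fcoeff_neg, neg_neg, map_mul, map_div₀, ← fcoeff_neg, neg_neg, Complex.conj_ofReal,
      ← Complex.exp_conj, map_mul, Complex.conj_I, Complex.conj_ofReal] at h2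
    rw [h2, Int.sign_eq_neg_one_of_neg hk]
    have h3 : |(k : ℝ)| = ((-k : ℤ) : ℝ) := by
      push_cast; exact abs_of_neg (by exact_mod_cast hk)
    rw [h3]
    congr 2
    push_cast; ring
  · rw [hpos k hk, Int.sign_eq_one_of_pos hk]
    have h3 : |(k : ℝ)| = k := abs_of_pos (by exact_mod_cast hk)
    rw [h3]
    simp

theorem integral_eq_zero_of_fcoeff_zero {φ : Circle2Pi → ℝ} (h : fcoeff φ 0 = 0) :
    ∫ x, φ x = 0 := by
  rw [fcoeff, fourierCoeff, integral_haarAddCircle] at h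
  have hpi : (2 * Real.pi)⁻¹ ≠ 0 := inv_ne_zero Real.two_pi_pos.ne'
  have h1 := (smul_eq_zero.1 h).resolve_left hpi
  simp only [neg_zero, fourier_zero, one_smul] at h1
  rw [integral_complex_ofReal] at h1
  exact_mod_cast h1

/-- All nonzero coefficients of the test function are equal, so no choice of harmonics to remove is
better than another for this bound. -/
theorem exists_le_bestOrthClass {p : ℝ} (hp : 1 < p) (hψ : MemMTwo ψ)
    (hψ' : IncreasesToInfinity (fun t => ψ t / |rightDeriv ψ t|)) (β : ℝ) :
    ∃ c : ℝ, 0 < c ∧ ∀ n : ℕ, 1 ≤ n → ∀ m : ℕ, m ≤ 2 * n →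
      ENNReal.ofReal (c * (ψ n * (eta ψ n - n) ^ (1 / p))) ≤
        bestOrthClass m ⊤ (psiBetaClass ψ β (ENNReal.ofReal p)) := by
  obtain ⟨C, hC, hsum⟩ := exists_sum_inv_le hψ hψ'
  obtain ⟨K, hK0, hK⟩ := hψ.eta_sub_ge
  have hM := hψ.toMemM
  have hp0 : 0 < p := by linarith
  have hτ : tailConst p ^ (1 / p) ≠ ⊤ :=
    ENNReal.rpow_ne_top_of_nonneg (by positivity) (tailConst_lt_top hp).ne
  set τ := (tailConst p ^ (1 / p)).toReal with hτ'
  have hτ0 : 0 ≤ τ := ENNReal.toReal_nonneg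
  set B := (1 + Real.pi) * C with hB
  have hB0 : 0 < B := by positivity
  refine ⟨1 / (4 * B * (τ + 1)), by positivity, fun n hn m hm => ?_⟩
  have hn1 : (1 : ℝ) ≤ n := by exact_mod_cast hn
  have hpos := hM.pos n hn1
  have ha0 : 0 < eta ψ n - n := hK0.trans_le (hK n hn1)
  obtain ⟨hratio, hsumn⟩ := hsum n hn
  -- This degree leaves N - n ≥ a, while ψ(N) is still comparable with ψ(n).
  set N := ⌈eta ψ n⌉₊ with hN
  have hNη : eta ψ n ≤ N := Nat.le_ceil _
  set a := eta ψ n - n with ha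
  have hnN : n ≤ N := by
    have : (n : ℝ) ≤ N := by linarith
    exact_mod_cast this
  -- Chosen so that (2/A) · 2Bτ a^(1 - 1/p) ≤ 1, which puts the derivative in the unit ball; τ + 1
  -- replaces τ to keep A positive.
  set A := 4 * B * (τ + 1) * a ^ (1 - 1 / p) with hA
  have hA0 : 0 < A := by positivity
  set w := ψ n / A with hw
  have hw0 : 0 < w := by positivity
  set G : Circle2Pi → ℂ := fun x =>
    ∑ k ∈ Finset.Ico 1 (N + 1), ((ψ n / ψ k : ℝ) : ℂ) * fourier (k : ℤ) x with hG
  have hGp : eLpNorm G (ENNReal.ofReal p) volume ≤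
      ENNReal.ofReal (2 * B * a ^ (1 - 1 / p) * τ) := by
    have h1 := eLpNorm_le_of_peak hp ha0 hB0.le G (fun t _ => by
      calc ‖G t‖ ≤ ∑ k ∈ Finset.Ico 1 (N + 1), ψ n / ψ k := by
            refine norm_sum_le_of_le _ fun k hk => ?_
            have hk1 : (1 : ℝ) ≤ k := by exact_mod_cast (Finset.mem_Ico.1 hk).1
            have := hM.pos k hk1
            rw [norm_mul, norm_fourier_apply, mul_one, Complex.norm_real, Real.norm_eq_abs,
              abs_of_pos (by positivity)]
        _ ≤ C * a := hsumn
        _ ≤ B * a := by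
            have : 0 ≤ Real.pi * C * a := by positivity
            rw [hB]; linarith)
      (fun t ht => by
        refine (abs_mul_norm_sum_monotone_le ht (fun k => ψ n / ψ k) N (fun k hk => ?_)
          (fun k hk => ?_) (hn.trans hnN)).trans ?_
        · have := hM.pos k (by exact_mod_cast hk)
          positivity
        · have hk1 : (1 : ℝ) ≤ k := by exact_mod_cast hk
          have hk2 : (1 : ℝ) ≤ (k + 1 : ℕ) := by push_cast; linarith
          exact div_le_div_of_nonneg_left hpos.le (hM.pos _ hk2)
            (hM.antitoneOn hk1 hk2 (by push_cast; linarith))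
        · have := mul_le_mul_of_nonneg_left hratio Real.pi_pos.le
          rw [hB]; linarith)
    rwa [← ENNReal.ofReal_toReal hτ, ← hτ', ← ENNReal.ofReal_mul (by positivity)] at h1
  set φ := realTrigPoly N fun k =>
      ((w / ψ k : ℝ) : ℂ) * Complex.exp (Complex.I * ((β * Real.pi / 2 : ℝ) : ℂ)) with hφ
  have hφG : ∀ x, ‖φ x‖ ≤ 2 / A * ‖G x‖ := by
    intro x
    have h1 : ∑ k ∈ Finset.Icc (1 : ℤ) N, (((w / ψ k : ℝ) : ℂ) *
        Complex.exp (Complex.I * ((β * Real.pi / 2 : ℝ) : ℂ))) * fourier k x =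
        Complex.exp (Complex.I * ((β * Real.pi / 2 : ℝ) : ℂ)) * ((A⁻¹ : ℝ) : ℂ) * G x := by
      rw [hG, Finset.mul_sum]
      refine Finset.sum_nbij' (fun k => k.toNat) (fun k => (k : ℤ)) ?_ ?_ ?_ ?_ ?_
      · intro k hk; rw [Finset.mem_Icc] at hk; rw [Finset.mem_Ico]; omega
      · intro k hk; rw [Finset.mem_Ico] at hk; rw [Finset.mem_Icc]; omega
      · intro k hk; rw [Finset.mem_Icc] at hk; omega
      · intro k hk; simp
      · intro k hk
        have hk0 := (Finset.mem_Icc.1 hk).1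
        have e1 : ((k.toNat : ℕ) : ℤ) = k := by omega
        have e2 : ((k.toNat : ℕ) : ℝ) = (k : ℝ) := by exact_mod_cast congrArg (Int.cast : ℤ → ℝ) e1
        rw [e1, e2, hw]
        push_cast
        ring
    have h2 : ‖Complex.exp (Complex.I * ((β * Real.pi / 2 : ℝ) : ℂ))‖ = 1 := by
      rw [mul_comm, Complex.norm_exp_ofReal_mul_I]
    rw [hφ, realTrigPoly, h1, norm_mul, Real.norm_eq_abs, Real.norm_eq_abs, abs_two]
    have h3 : 2 / A * ‖G x‖ = 2 * (A⁻¹ * ‖G x‖) := by ring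
    rw [h3]
    refine mul_le_mul_of_nonneg_left ((Complex.abs_re_le_norm _).trans_eq ?_)
      (zero_le_two (α := ℝ))
    rw [norm_mul, norm_mul, h2, one_mul, Complex.norm_real, Real.norm_eq_abs,
      abs_of_pos (inv_pos.2 hA0)]
  have hφc : Continuous φ := continuous_realTrigPoly N _
  have hnorm : eLpNorm φ (ENNReal.ofReal p) volume ≤ 1 := by
    refine (eLpNorm_le_mul_eLpNorm_of_ae_le_mul (ae_of_all _ hφG) _).trans ?_
    refine (mul_le_mul_right hGp _).trans ?_
    rw [← ENNReal.ofReal_mul (by positivity), ← ENNReal.ofReal_one]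
    refine ENNReal.ofReal_le_ofReal ?_
    rw [div_mul_eq_mul_div, div_le_one hA0, hA]
    have : 0 ≤ B * a ^ (1 - 1 / p) := by positivity
    linarith
  have hderiv := isPsiBetaDeriv_realTrigPoly ψ β N w
  rw [← hφ] at hderiv
  have hmem : realTrigPoly N (fun _ => (w : ℂ)) ∈ psiBetaClass ψ β (ENNReal.ofReal p) :=
    ⟨integrable_realTrigPoly N _, φ, hderiv,
      ⟨hφc.aestronglyMeasurable, hnorm.trans_lt ENNReal.one_lt_top⟩, hnorm,
      integral_eq_zero_of_fcoeff_zero hderiv.2.1⟩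
  refine le_trans ?_ (le_iSup₂ (f := fun f (_ : f ∈ psiBetaClass ψ β (ENNReal.ofReal p)) =>
    bestOrth m ⊤ f) _ hmem)
  refine le_iInf fun γ => ?_
  refine le_trans (ENNReal.ofReal_le_ofReal ?_)
    (le_eLpNorm_dirichlet_sub_partialSum hw0.le hnN (hn.trans hnN) γ.1 (γ.2.le.trans hm))
  calc 1 / (4 * B * (τ + 1)) * (ψ n * a ^ (1 / p)) = w * a := by
        rw [hw, hA]
        have h1 : a ^ (1 - 1 / p) = a / a ^ (1 / p) := by
          rw [Real.rpow_sub ha0, Real.rpow_one]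
        have h2 : 0 < a ^ (1 / p) := by positivity
        rw [h1]
        field_simp
    _ ≤ w * (N - n) := by gcongr; linarith

theorem SameOrder.of_bounds {a b R : ℕ → ℝ≥0∞} {c₁ C₁ c₂ C₂ : ℝ≥0} (hc₁ : 0 < c₁) (hC₁ : 0 < C₁)
    (hc₂ : 0 < c₂) (hC₂ : 0 < C₂)
    (ha : ∀ n, 1 ≤ n → (c₁ : ℝ≥0∞) * R n ≤ a n ∧ a n ≤ C₁ * R n)
    (hb : ∀ n, 1 ≤ n → (c₂ : ℝ≥0∞) * R n ≤ b n ∧ b n ≤ C₂ * R n) : SameOrder a b := by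
  refine ⟨c₂ / C₁, C₂ / c₁, by positivity, by positivity, fun n hn => ⟨?_, ?_⟩⟩
  · calc ((c₂ / C₁ : ℝ≥0) : ℝ≥0∞) * a n ≤ ((c₂ / C₁ : ℝ≥0) : ℝ≥0∞) * (C₁ * R n) := by
          gcongr; exact (ha n hn).2
      _ = c₂ * R n := by
          rw [← mul_assoc, ← ENNReal.coe_mul, div_mul_cancel₀ _ hC₁.ne']
      _ ≤ b n := (hb n hn).1
  · calc b n ≤ C₂ * R n := (hb n hn).2
      _ = ((C₂ / c₁ : ℝ≥0) : ℝ≥0∞) * (c₁ * R n) := by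
          rw [← mul_assoc, ← ENNReal.coe_mul, div_mul_cancel₀ _ hc₁.ne']
      _ ≤ _ := by gcongr; exact (ha n hn).1

end OrthApprox

theorem theorem1 (p : ℝ) (hp : 1 < p) (ψ : ℝ → ℝ) (hψ : OrthApprox.MemMTwo ψ)
    (hψ' : OrthApprox.IncreasesToInfinity (fun t => ψ t / |OrthApprox.rightDeriv ψ t|))
    (β : ℝ) :
    OrthApprox.SameOrder
        (fun n => OrthApprox.bestOrthClass (2 * n - 1) ⊤
          (OrthApprox.psiBetaClass ψ β (ENNReal.ofReal p)))
        (fun n => OrthApprox.bestOrthClass (2 * n) ⊤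
          (OrthApprox.psiBetaClass ψ β (ENNReal.ofReal p))) ∧
      OrthApprox.SameOrder
        (fun n => OrthApprox.bestOrthClass (2 * n) ⊤
          (OrthApprox.psiBetaClass ψ β (ENNReal.ofReal p)))
        (fun n => ENNReal.ofReal (ψ n * (OrthApprox.eta ψ n - n) ^ (1 / p))) := by
  obtain ⟨C, hC, hupper⟩ := OrthApprox.exists_bestOrthClass_le hp hψ β
  obtain ⟨c, hc, hlower⟩ := OrthApprox.exists_le_bestOrthClass hp hψ hψ' β
  have hC' : 0 < C.toNNReal := Real.toNNReal_pos.2 hC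
  have hc' : 0 < c.toNNReal := Real.toNNReal_pos.2 hc
  have key : ∀ n : ℕ, 1 ≤ n → ∀ m : ℕ, m = 2 * n - 1 ∨ m = 2 * n →
      (c.toNNReal : ℝ≥0∞) * ENNReal.ofReal (ψ n * (OrthApprox.eta ψ n - n) ^ (1 / p)) ≤
        OrthApprox.bestOrthClass m ⊤ (OrthApprox.psiBetaClass ψ β (ENNReal.ofReal p)) ∧
      OrthApprox.bestOrthClass m ⊤ (OrthApprox.psiBetaClass ψ β (ENNReal.ofReal p)) ≤
        (C.toNNReal : ℝ≥0∞) *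
          ENNReal.ofReal (ψ n * (OrthApprox.eta ψ n - n) ^ (1 / p)) := by
    intro n hn m hm
    have h1 := hlower n hn m (by omega)
    have h2 := hupper n hn m hm
    rw [ENNReal.ofReal_mul hc.le] at h1
    rw [ENNReal.ofReal_mul hC.le] at h2
    exact ⟨h1, h2⟩
  exact ⟨.of_bounds hc' hC' hc' hC' (fun n hn => key n hn _ (.inl rfl))
      (fun n hn => key n hn _ (.inr rfl)),
    .of_bounds hc' hC' one_pos one_pos (fun n hn => key n hn _ (.inr rfl))
      (fun n _ => by simp)⟩
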